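/- Let $M$ be a (Hausdorff) $C^\infty$ manifold of real dimension $2n$ with a smooth almost Hermitian structure $(J,g)$: $g=\langle\cdot,\cdot\rangle$ is a smooth Riemannian metric and $J$ a smooth field of endomorphisms of the tangent spaces with $J^2=-1$ and $\langle JX,JY\rangle=\langle X,Y\rangle$. Let $\nabla$ be the Levi-Civita connection of $g$, let $$\bar\nabla_XY=\tfrac12\big(\nabla_XY-J\nabla_X(JY)\big)$$ be the canonical connection of $(J,g)$, let $h=\nabla-\bar\nabla$, so that $h_XY=\tfrac12(\nabla_XY+J\nabla_X(JY))$, and put $h_{XYZ}=\langle h_XY,Z\rangle$ and $\beta(Z)=\sum_{i=1}^{n}\big(h_{E_iE_iZ}+h_{JE_i\,JE_i\,Z}\big)$ for any local orthonormal frame $E_1,\dots,E_n,JE_1,\dots,JE_n$. Assume that $(J,g)$ is quasi-homogeneous, that is $\bar\nabla h=0$ on $M$: $$\bar\nabla_W(h_XY)-h_{\bar\nabla_WX}Y-h_X(\bar\nabla_WY)=0\qquad\text{for all smooth vector fields }W,X,Y,$$ and that $(J,g)$ is of type $\bar T_4=U_4$, that is, at every point of $M$ the tensor $h$ satisfies $h_{XYZ}=-h_{XZY}=-h_{X\,JY\,JZ}$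 and $$h_{XYZ}=\frac1{2(n-1)}\Big[\langle X,Y\rangle\beta(Z)-\langle X,Z\rangle\beta(Y)-\langle X,JY\rangle\beta(JZ)+\langle X,JZ\rangle\beta(JY)\Big]$$ (for $n=1$ the last condition is read as $h=0$). Then $g$ can be locally conformally changed into a Kähler metric: every point of $M$ has an open neighbourhood $U$ with a smooth function $\rho:U\to\mathbb R$ such that $(J,g')$ with $g'=e^{2\rho}g$ is a Kähler structure on $U$, that is, $(J,g')$ is almost Hermitian on $U$ and $\nabla'J=0$ on $U$, where $\nabla'$ is the Levi-Civita connection of $g'$. -/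

import Mathlib

open Set Bundle
open scoped Manifold ContDiff Topology

noncomputable section

namespace AlmostHermitian

/-! ### Linear algebra on one tangent space

`V` is a real vector space with an inner product `g` and an almost complex structure `J`. -/

section LinearAlgebra

variable {V : Type*} [AddCommGroup V] [Module ℝ V]

/-- The space `𝒯(V)` of all trilinear forms `h` on `V` with
`h(x,y,z) = -h(x,z,y) = -h(x,Jy,Jz)`. -/
def tensorSpace (J : V → V) : Set (V →ₗ[ℝ] V →ₗ[ℝ] V →ₗ[ℝ] ℝ) :=
  {h | ∀ x y z, h x y z = -h x z y ∧ h x y z = -h x (J y) (J z)}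

/-- `e₁, …, eₙ, Je₁, …, Jeₙ` is an orthonormal system; it is a basis when `dim V = 2n`. -/
def IsUnitaryFrame {n : ℕ} (g : V → V → ℝ) (J : V → V) (e : Fin n → V) : Prop :=
  ∀ i j, g (e i) (e j) = (if i = j then 1 else 0) ∧
    g (J (e i)) (J (e j)) = (if i = j then 1 else 0) ∧ g (e i) (J (e j)) = 0

/-- The contraction `β = c₁₂(h)`, that is `β(z) = ∑ᵢ h(eᵢ,eᵢ,z) + h(Jeᵢ,Jeᵢ,z)`, computed in
a unitary frame `e` of `V`, `dim V = 2n`. It does not depend on the frame. -/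
def contraction {n : ℕ} (J : V → V) (e : Fin n → V) (h : V →ₗ[ℝ] V →ₗ[ℝ] V →ₗ[ℝ] ℝ)
    (z : V) : ℝ :=
  ∑ i, (h (e i) (e i) z + h (J (e i)) (J (e i)) z)

/-- The subspace `𝒯₄(V)` of `𝒯(V)`, where `dim V = 2n`. For `n = 1` the coefficient
`1 / (2 * (n - 1))` is `0` here, so that `𝒯₄(V) = {0}`, which is then all of `𝒯(V)`. -/
def tensorSpaceFour (n : ℕ) (g : V → V → ℝ) (J : V → V) :
    Set (V →ₗ[ℝ] V →ₗ[ℝ] V →ₗ[ℝ] ℝ) :=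
  {h | h ∈ tensorSpace J ∧ ∃ e : Fin n → V, IsUnitaryFrame g J e ∧ ∀ x y z,
    h x y z = 1 / (2 * ((n : ℝ) - 1)) *
      (g x y * contraction J e h z - g x z * contraction J e h y
        - g x (J y) * contraction J e h (J z) + g x (J z) * contraction J e h (J y))}

end LinearAlgebra

/-! ### Connections on a manifold of dimension `d` -/

section Manifold

variable {d : ℕ} {M : Type*} [TopologicalSpace M] [ChartedSpace (EuclideanSpace ℝ (Fin d)) M]
  [IsManifold (𝓡 d) ∞ M]

/-- Vector fields on `M`, with no regularity. -/
abbrev VField (d : ℕ) (M : Type*) [TopologicalSpace M]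
    [ChartedSpace (EuclideanSpace ℝ (Fin d)) M] : Type _ :=
  (p : M) → TangentSpace (𝓡 d) p

/-- Fields of bilinear forms on the tangent spaces of `M`, with no regularity. -/
abbrev FormField (d : ℕ) (M : Type*) [TopologicalSpace M]
    [ChartedSpace (EuclideanSpace ℝ (Fin d)) M] : Type _ :=
  (p : M) → TangentSpace (𝓡 d) p →L[ℝ] TangentSpace (𝓡 d) p →L[ℝ] ℝ

/-- Fields of endomorphisms of the tangent spaces of `M`, with no regularity. -/
abbrev EndField (d : ℕ) (M : Type*) [TopologicalSpace M]
    [ChartedSpace (EuclideanSpace ℝ (Fin d)) M] : Type _ :=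
  (p : M) → TangentSpace (𝓡 d) p →L[ℝ] TangentSpace (𝓡 d) p

/-- `X` is a smooth vector field on the set `U`. -/
def SmoothOn (X : VField d M) (U : Set M) : Prop :=
  ContMDiffOn (𝓡 d) (𝓡 d).tangent ∞ (fun q => (⟨q, X q⟩ : TangentBundle (𝓡 d) M)) U

/-- `J X` for a field of endomorphisms `J` and a vector field `X`. -/
def applyEnd (J : EndField d M) (X : VField d M) : VField d M := fun p => J p (X p)

/-- Derivative at `p` of the function `f` in the direction of the tangent vector `v`. -/
def dirDeriv (f : M → ℝ) (p : M) (v : TangentSpace (𝓡 d) p) : ℝ :=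
  mvfderiv (𝓡 d) f p v

/-- The right-hand side of the Koszul formula
`2⟨∇_X Y, Z⟩ = X⟨Y,Z⟩ + Y⟨Z,X⟩ - Z⟨X,Y⟩ + ⟨[X,Y],Z⟩ - ⟨[X,Z],Y⟩ - ⟨[Y,Z],X⟩`, halved. -/
def koszul (g : FormField d M) (X Y Z : VField d M) (p : M) : ℝ :=
  (1 / 2) *
    (dirDeriv (fun q => g q (Y q) (Z q)) p (X p)
      + dirDeriv (fun q => g q (Z q) (X q)) p (Y p)
      - dirDeriv (fun q => g q (X q) (Y q)) p (Z p)
      + g p (VectorField.mlieBracket (𝓡 d) X Y p) (Z p)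
      - g p (VectorField.mlieBracket (𝓡 d) X Z p) (Y p)
      - g p (VectorField.mlieBracket (𝓡 d) Y Z p) (X p))

open Classical in
/-- The Riemannian (Levi-Civita) connection `∇_X Y` of the metric `g`: its value at `p` is the
tangent vector `v` with `⟨v, Z⟩ = ⟨∇_X Y, Z⟩` as given by the Koszul formula, for all vector
fields `Z` differentiable at `p`. There is exactly one such `v` when `g` is a smooth metric near
`p` and `X`, `Y` are differentiable at `p`; the value is `0` if there is none. -/
def leviCivita (g : FormField d M) (X Y : VField d M) : VField d M := fun p =>
  if h : ∃ v : TangentSpace (𝓡 d) p, ∀ Z : VField d M,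
      MDifferentiableAt (𝓡 d) (𝓡 d).tangent
        (fun q => (⟨q, Z q⟩ : TangentBundle (𝓡 d) M)) p →
      g p v (Z p) = koszul g X Y Z p
  then h.choose else 0

/-- The canonical connection `∇̄_X Y = ½ (∇_X Y - J ∇_X (J Y))` of the pair `(J, g)`. -/
def canonicalConnection (g : FormField d M) (J : EndField d M) (X Y : VField d M) :
    VField d M := fun p =>
  (1 / 2 : ℝ) • (leviCivita g X Y p - J p (leviCivita g X (applyEnd J Y) p))

/-- The second fundamental tensor field `h = ∇ - ∇̄` of the pair `(J, g)`, on vector fields. -/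
def secondFundamental (g : FormField d M) (J : EndField d M) (X Y : VField d M) :
    VField d M := fun p =>
  leviCivita g X Y p - canonicalConnection g J X Y p

/-- The value at `p` of the tensor `h(x,y,z) = ⟨h_x y, z⟩`. The tangent vectors `x`, `y` are
extended to vector fields that are smooth near `p`; the value does not depend on how. -/
def secondFundamentalAt (g : FormField d M) (J : EndField d M) (p : M)
    (x y z : TangentSpace (𝓡 d) p) : ℝ :=
  g p (secondFundamental g J (FiberBundle.extend (EuclideanSpace ℝ (Fin d)) x)
    (FiberBundle.extend (EuclideanSpace ℝ (Fin d)) y) p) z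

/-- `(J, g)` is a smooth almost Hermitian structure on the open set `U`: there `g` is a smooth
Riemannian metric, `J` is a smooth field of endomorphisms, `J² = -1` and `⟨Jx,Jy⟩ = ⟨x,y⟩`. -/
structure IsAlmostHermitianOn (g : FormField d M) (J : EndField d M) (U : Set M) : Prop where
  contMDiffOn_metric : ContMDiffOn (𝓡 d)
    ((𝓡 d).prod 𝓘(ℝ, EuclideanSpace ℝ (Fin d) →L[ℝ] EuclideanSpace ℝ (Fin d) →L[ℝ] ℝ)) ∞
    (fun p => TotalSpace.mk'
      (EuclideanSpace ℝ (Fin d) →L[ℝ] EuclideanSpace ℝ (Fin d) →L[ℝ] ℝ)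
      (E := fun p : M => TangentSpace (𝓡 d) p →L[ℝ] TangentSpace (𝓡 d) p →L[ℝ] ℝ) p (g p)) U
  symm : ∀ p ∈ U, ∀ x y, g p x y = g p y x
  pos : ∀ p ∈ U, ∀ x, x ≠ 0 → 0 < g p x x
  contMDiffOn_complex : ContMDiffOn (𝓡 d)
    ((𝓡 d).prod 𝓘(ℝ, EuclideanSpace ℝ (Fin d) →L[ℝ] EuclideanSpace ℝ (Fin d))) ∞
    (fun p => TotalSpace.mk' (EuclideanSpace ℝ (Fin d) →L[ℝ] EuclideanSpace ℝ (Fin d))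
      (E := fun p : M => TangentSpace (𝓡 d) p →L[ℝ] TangentSpace (𝓡 d) p) p (J p)) U
  sq : ∀ p ∈ U, ∀ x, J p (J p x) = -x
  compatible : ∀ p ∈ U, ∀ x y, g p (J p x) (J p y) = g p x y

/-- The almost Hermitian structure `(J, g)` is of type `𝒯₄ = U₄`, where `dim M = 2n`: at every
point the tensor `h` belongs to `𝒯₄` of the tangent space. -/
def IsTypeFour (n : ℕ) (g : FormField d M) (J : EndField d M) : Prop :=
  ∀ p : M, ∃ h ∈ tensorSpaceFour n (fun x y => g p x y) (fun x => J p x),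
    ∀ x y z, h x y z = secondFundamentalAt g J p x y z

/-- `(J, g)` is quasi-homogeneous, `∇̄ h = 0`: for all smooth vector fields `W`, `X`, `Y`,
`(∇̄_W h)(X, Y) = ∇̄_W (h_X Y) - h_{∇̄_W X} Y - h_X (∇̄_W Y) = 0`. -/
def IsQuasiHomogeneous (g : FormField d M) (J : EndField d M) : Prop :=
  ∀ W X Y : VField d M, SmoothOn W univ → SmoothOn X univ → SmoothOn Y univ → ∀ p,
    canonicalConnection g J W (secondFundamental g J X Y) p
      - secondFundamental g J (canonicalConnection g J W X) Y p
      - secondFundamental g J X (canonicalConnection g J W Y) p = 0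

/-- `(J, g)` is a Kähler structure on the open set `U`: it is almost Hermitian there and
`∇ J = 0`, that is `∇_X (J Y) = J (∇_X Y)`. -/
def IsKahlerOn (g : FormField d M) (J : EndField d M) (U : Set M) : Prop :=
  IsAlmostHermitianOn g J U ∧
    ∀ X Y : VField d M, SmoothOn X U → SmoothOn Y U → ∀ p ∈ U,
      leviCivita g X (applyEnd J Y) p = J p (leviCivita g X Y p)

/-- The conformally changed metric `e^{2ρ} g`. -/
def conformalChange (ρ : M → ℝ) (g : FormField d M) : FormField d M := fun p =>
  Real.exp (2 * ρ p) • g p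

end Manifold

end AlmostHermitian

end

/-! The tensor `h` is governed by a one-form, and that one-form turns out to be closed; its local
primitive is the conformal exponent.

Put α = β/(n-1), with α = 0 when n = 1. Type U₄ says that `h` is half of `leeTensor` of α. The
canonical connection ∇̄ preserves both the metric and J, so differentiating this identity and using
∇̄h = 0 shows that the `leeTensor` of ∇̄α vanishes. The trace of x ↦ h_x y is (1-n) α(y), so α ↦
`leeTensor` α is injective when the dimension is not 2, and therefore ∇̄α = 0
(`IsLeeForm.dirDeriv_apply`).

For a ∇̄-parallel form, dα(X,Y) is α of the torsion of ∇̄, namely α(h_Y X - h_X Y). If A is the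
metric dual of α, then ⟨h_X Y, A⟩ is symmetric in X and Y (`IsAlmostHermitianOn.leeTensor_swap`), so
dα = 0. The Poincaré lemma gives α = dρ locally.

Passing to e^{2ρ}g replaces ∇_X Y by ∇_X Y + dρ(X)Y + dρ(Y)X - ⟨X,Y⟩ grad ρ. Paired by g, this
changes ⟨h_X Y, Z⟩ by minus half of `leeTensor` of dρ, which cancels it exactly. Hence the new h is
0, that is, ∇'J = 0.

Since the Levi-Civita connection and α are given pointwise by choice, their smoothness has to be
recovered: for ∇ by Cramer's rule in a local frame, for α by the trace formula. -/

set_option linter.unusedSectionVars false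

noncomputable section

namespace AlmostHermitian

/-! ### Directional derivatives and regularity of pairings. -/

section Regularity

section dirDeriv

variable {d : ℕ} {M : Type*} [TopologicalSpace M] [ChartedSpace (EuclideanSpace ℝ (Fin d)) M]
  {p : M} {f f' : M → ℝ} (v : TangentSpace (𝓡 d) p)

theorem dirDeriv_add (hf : MDifferentiableAt (𝓡 d) 𝓘(ℝ) f p)
    (hf' : MDifferentiableAt (𝓡 d) 𝓘(ℝ) f' p) :
    dirDeriv (fun q => f q + f' q) p v = dirDeriv f p v + dirDeriv f' p v := by
  simp [dirDeriv, mvfderiv_fun_add hf hf']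

theorem dirDeriv_sub (hf : MDifferentiableAt (𝓡 d) 𝓘(ℝ) f p)
    (hf' : MDifferentiableAt (𝓡 d) 𝓘(ℝ) f' p) :
    dirDeriv (fun q => f q - f' q) p v = dirDeriv f p v - dirDeriv f' p v := by
  simp [dirDeriv, mvfderiv_fun_sub hf hf']

theorem dirDeriv_mul (hf : MDifferentiableAt (𝓡 d) 𝓘(ℝ) f p)
    (hf' : MDifferentiableAt (𝓡 d) 𝓘(ℝ) f' p) :
    dirDeriv (fun q => f q * f' q) p v = f p * dirDeriv f' p v + f' p * dirDeriv f p v := by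
  simp [dirDeriv, mvfderiv_fun_mul hf hf']

theorem dirDeriv_congr (h : f =ᶠ[𝓝 p] f') : dirDeriv f p v = dirDeriv f' p v := by
  simp only [dirDeriv, mvfderiv, h.mfderiv_eq]
  rfl

theorem dirDeriv_add_vector (w : TangentSpace (𝓡 d) p) :
    dirDeriv f p (v + w) = dirDeriv f p v + dirDeriv f p w := map_add _ _ _

theorem dirDeriv_smul_vector (c : ℝ) :
    dirDeriv f p (c • v) = c * dirDeriv f p v := map_smul _ _ _

end dirDeriv

variable {d : ℕ} {M : Type*} [TopologicalSpace M] [ChartedSpace (EuclideanSpace ℝ (Fin d)) M]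
  [IsManifold (𝓡 d) ∞ M]

/-- The vector field `X` is differentiable at `p`. -/
abbrev DiffAt (X : VField d M) (p : M) : Prop :=
  MDifferentiableAt (𝓡 d) (𝓡 d).tangent (fun q => (⟨q, X q⟩ : TangentBundle (𝓡 d) M)) p

/-- `g` is a smooth Riemannian metric on `U`. -/
structure IsMetricOn (g : FormField d M) (U : Set M) : Prop where
  contMDiffOn : ContMDiffOn (𝓡 d)
    ((𝓡 d).prod 𝓘(ℝ, EuclideanSpace ℝ (Fin d) →L[ℝ] EuclideanSpace ℝ (Fin d) →L[ℝ] ℝ)) ∞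
    (fun p => TotalSpace.mk'
      (EuclideanSpace ℝ (Fin d) →L[ℝ] EuclideanSpace ℝ (Fin d) →L[ℝ] ℝ)
      (E := fun p : M => TangentSpace (𝓡 d) p →L[ℝ] TangentSpace (𝓡 d) p →L[ℝ] ℝ) p (g p)) U
  symm : ∀ p ∈ U, ∀ x y, g p x y = g p y x
  pos : ∀ p ∈ U, ∀ x, x ≠ 0 → 0 < g p x x

variable {g : FormField d M} {J : EndField d M} {U : Set M} {p : M}

theorem IsAlmostHermitianOn.isMetricOn (h : IsAlmostHermitianOn g J U) : IsMetricOn g U :=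
  ⟨h.contMDiffOn_metric, h.symm, h.pos⟩

theorem IsAlmostHermitianOn.mono {V : Set M} (h : IsAlmostHermitianOn g J U) (hV : V ⊆ U) :
    IsAlmostHermitianOn g J V :=
  ⟨h.contMDiffOn_metric.mono hV, fun q hq => h.symm q (hV hq), fun q hq => h.pos q (hV hq),
    h.contMDiffOn_complex.mono hV, fun q hq => h.sq q (hV hq), fun q hq => h.compatible q (hV hq)⟩

theorem SmoothOn.diffAt {X : VField d M} (hX : SmoothOn X U) (hU : IsOpen U) (hp : p ∈ U) :
    DiffAt X p :=
  (hX.contMDiffAt (hU.mem_nhds hp)).mdifferentiableAt (by simp)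

theorem diffAt_extend (x : TangentSpace (𝓡 d) p) :
    DiffAt (FiberBundle.extend (EuclideanSpace ℝ (Fin d)) x) p :=
  FiberBundle.mdifferentiableAt_extend ..

theorem DiffAt.add {X Y : VField d M} (hX : DiffAt X p) (hY : DiffAt Y p) : DiffAt (X + Y) p :=
  mdifferentiableAt_add_section hX hY

theorem DiffAt.smul {f : M → ℝ} {X : VField d M} (hf : MDifferentiableAt (𝓡 d) 𝓘(ℝ) f p)
    (hX : DiffAt X p) : DiffAt (f • X) p :=
  hf.smul_section hX

theorem IsMetricOn.mdifferentiableAt_pairing (hg : IsMetricOn g U) (hU : IsOpen U) (hp : p ∈ U)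
    {Y Z : VField d M} (hY : DiffAt Y p) (hZ : DiffAt Z p) :
    MDifferentiableAt (𝓡 d) 𝓘(ℝ) (fun q => g q (Y q) (Z q)) p := by
  have h : MDifferentiableAt (𝓡 d) ((𝓡 d).prod 𝓘(ℝ))
      (fun q => TotalSpace.mk' ℝ (E := Bundle.Trivial M ℝ) q (g q (Y q) (Z q))) p := by
    apply MDifferentiableAt.clm_bundle_apply₂ (F₁ := EuclideanSpace ℝ (Fin d))
      (F₂ := EuclideanSpace ℝ (Fin d))
    · exact (hg.contMDiffOn.contMDiffAt (hU.mem_nhds hp)).mdifferentiableAt (by simp)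
    · exact hY
    · exact hZ
  simp only [mdifferentiableAt_totalSpace] at h
  exact h.2

theorem IsMetricOn.contMDiffOn_pairing (hg : IsMetricOn g U)
    {Y Z : VField d M} (hY : SmoothOn Y U) (hZ : SmoothOn Z U) :
    ContMDiffOn (𝓡 d) 𝓘(ℝ) ∞ (fun q => g q (Y q) (Z q)) U := by
  intro p hp
  have h : ContMDiffWithinAt (𝓡 d) ((𝓡 d).prod 𝓘(ℝ)) ∞
      (fun q => TotalSpace.mk' ℝ (E := Bundle.Trivial M ℝ) q (g q (Y q) (Z q))) U p := by
    apply ContMDiffWithinAt.clm_bundle_apply₂ (F₁ := EuclideanSpace ℝ (Fin d))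
      (F₂ := EuclideanSpace ℝ (Fin d))
    · exact hg.contMDiffOn p hp
    · exact hY p hp
    · exact hZ p hp
  simp only [contMDiffWithinAt_totalSpace] at h
  exact h.2

theorem IsAlmostHermitianOn.diffAt_applyEnd (h : IsAlmostHermitianOn g J U) (hU : IsOpen U)
    (hp : p ∈ U) {X : VField d M} (hX : DiffAt X p) : DiffAt (applyEnd J X) p :=
  MDifferentiableAt.clm_bundle_apply
    ((h.contMDiffOn_complex.contMDiffAt (hU.mem_nhds hp)).mdifferentiableAt (by simp)) hX

theorem IsAlmostHermitianOn.smoothOn_applyEnd (h : IsAlmostHermitianOn g J U)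
    {X : VField d M} (hX : SmoothOn X U) : SmoothOn (applyEnd J X) U :=
  ContMDiffOn.clm_bundle_apply h.contMDiffOn_complex hX

end Regularity

/-! ### The Koszul formula and the Levi-Civita connection. -/

section LeviCivita

variable {d : ℕ} {M : Type*} [TopologicalSpace M] [ChartedSpace (EuclideanSpace ℝ (Fin d)) M]
  [IsManifold (𝓡 d) ∞ M] {g : FormField d M} {U : Set M} {p : M}

instance (p : M) : FiniteDimensional ℝ (TangentSpace (𝓡 d) p) :=
  inferInstanceAs (FiniteDimensional ℝ (EuclideanSpace ℝ (Fin d)))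

namespace IsMetricOn

theorem eq_of_pairing_eq (hg : IsMetricOn g U) (hp : p ∈ U) {v w : TangentSpace (𝓡 d) p}
    (h : ∀ z, g p v z = g p w z) : v = w := by
  by_contra hne
  have h1 := hg.pos p hp (v - w) (sub_ne_zero.2 hne)
  have h2 := h (v - w)
  simp only [map_sub, sub_apply] at h1 h2
  linarith

theorem exists_riesz (hg : IsMetricOn g U) (hp : p ∈ U)
    (φ : TangentSpace (𝓡 d) p →ₗ[ℝ] ℝ) : ∃ v, ∀ z, g p v z = φ z := by
  let Φ : TangentSpace (𝓡 d) p →ₗ[ℝ] Module.Dual ℝ (TangentSpace (𝓡 d) p) :=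
    { toFun := fun v => (g p v).toLinearMap
      map_add' := fun v w => by ext; simp
      map_smul' := fun c w => by ext; simp }
  have hinj : Function.Injective Φ := fun v w h =>
    hg.eq_of_pairing_eq hp fun z => LinearMap.congr_fun h z
  obtain ⟨v, hv⟩ := (LinearMap.injective_iff_surjective_of_finrank_eq_finrank
    Subspace.dual_finrank_eq.symm).1 hinj φ
  exact ⟨v, fun z => LinearMap.congr_fun hv z⟩

end IsMetricOn

section Bracket

variable {f : M → ℝ} {X Y Z : VField d M}

theorem lieBracket_smul_right (hf : MDifferentiableAt (𝓡 d) 𝓘(ℝ) f p) (hY : DiffAt Y p) :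
    VectorField.mlieBracket (𝓡 d) X (f • Y) p =
      dirDeriv f p (X p) • Y p + f p • VectorField.mlieBracket (𝓡 d) X Y p :=
  VectorField.mlieBracket_smul_right hf hY

theorem lieBracket_smul_left (hf : MDifferentiableAt (𝓡 d) 𝓘(ℝ) f p) (hX : DiffAt X p) :
    VectorField.mlieBracket (𝓡 d) (f • X) Y p =
      -dirDeriv f p (Y p) • X p + f p • VectorField.mlieBracket (𝓡 d) X Y p :=
  VectorField.mlieBracket_smul_left hf hX

end Bracket

section Pairing

variable {f : M → ℝ} {X Y Z : VField d M}

theorem dirDeriv_pairing_symm (hg : IsMetricOn g U) (hU : IsOpen U) (hp : p ∈ U) (Y Z : VField d M)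
    (v : TangentSpace (𝓡 d) p) :
    dirDeriv (fun q => g q (Y q) (Z q)) p v = dirDeriv (fun q => g q (Z q) (Y q)) p v :=
  dirDeriv_congr v (Filter.eventuallyEq_of_mem (hU.mem_nhds hp) fun q hq => hg.symm q hq _ _)

theorem dirDeriv_pairing_add_left (hg : IsMetricOn g U) (hU : IsOpen U) (hp : p ∈ U)
    (hX : DiffAt X p) (hY : DiffAt Y p) (hZ : DiffAt Z p) (v : TangentSpace (𝓡 d) p) :
    dirDeriv (fun q => g q ((X + Y) q) (Z q)) p v =
      dirDeriv (fun q => g q (X q) (Z q)) p v + dirDeriv (fun q => g q (Y q) (Z q)) p v := by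
  rw [← dirDeriv_add v (hg.mdifferentiableAt_pairing hU hp hX hZ)
    (hg.mdifferentiableAt_pairing hU hp hY hZ)]
  simp

theorem dirDeriv_pairing_add_right (hg : IsMetricOn g U) (hU : IsOpen U) (hp : p ∈ U)
    (hX : DiffAt X p) (hY : DiffAt Y p) (hZ : DiffAt Z p) (v : TangentSpace (𝓡 d) p) :
    dirDeriv (fun q => g q (Z q) ((X + Y) q)) p v =
      dirDeriv (fun q => g q (Z q) (X q)) p v + dirDeriv (fun q => g q (Z q) (Y q)) p v := by
  rw [← dirDeriv_add v (hg.mdifferentiableAt_pairing hU hp hZ hX)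
    (hg.mdifferentiableAt_pairing hU hp hZ hY)]
  simp

theorem dirDeriv_pairing_smul_left (hg : IsMetricOn g U) (hU : IsOpen U) (hp : p ∈ U)
    (hf : MDifferentiableAt (𝓡 d) 𝓘(ℝ) f p) (hX : DiffAt X p) (hZ : DiffAt Z p)
    (v : TangentSpace (𝓡 d) p) :
    dirDeriv (fun q => g q ((f • X) q) (Z q)) p v =
      f p * dirDeriv (fun q => g q (X q) (Z q)) p v + g p (X p) (Z p) * dirDeriv f p v := by
  rw [← dirDeriv_mul v hf (hg.mdifferentiableAt_pairing hU hp hX hZ)]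
  simp

theorem dirDeriv_pairing_smul_right (hg : IsMetricOn g U) (hU : IsOpen U) (hp : p ∈ U)
    (hf : MDifferentiableAt (𝓡 d) 𝓘(ℝ) f p) (hX : DiffAt X p) (hZ : DiffAt Z p)
    (v : TangentSpace (𝓡 d) p) :
    dirDeriv (fun q => g q (Z q) ((f • X) q)) p v =
      f p * dirDeriv (fun q => g q (Z q) (X q)) p v + g p (Z p) (X p) * dirDeriv f p v := by
  rw [← dirDeriv_mul v hf (hg.mdifferentiableAt_pairing hU hp hZ hX)]
  simp

end Pairing

section Koszul

variable {f : M → ℝ} {X X' Y Y' Z Z' : VField d M}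

theorem koszul_add_right (hg : IsMetricOn g U) (hU : IsOpen U) (hp : p ∈ U)
    (hX : DiffAt X p) (hY : DiffAt Y p) (hZ : DiffAt Z p) (hZ' : DiffAt Z' p) :
    koszul g X Y (Z + Z') p = koszul g X Y Z p + koszul g X Y Z' p := by
  simp only [koszul, dirDeriv_pairing_add_left hg hU hp hZ hZ' hX,
    dirDeriv_pairing_add_right hg hU hp hZ hZ' hY]
  simp only [Pi.add_apply, dirDeriv_add_vector,
    VectorField.mlieBracket_add_right hZ hZ', map_add, add_apply]
  ring

theorem koszul_smul_right (hg : IsMetricOn g U) (hU : IsOpen U) (hp : p ∈ U)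
    (hf : MDifferentiableAt (𝓡 d) 𝓘(ℝ) f p)
    (hX : DiffAt X p) (hY : DiffAt Y p) (hZ : DiffAt Z p) :
    koszul g X Y (f • Z) p = f p * koszul g X Y Z p := by
  simp only [koszul, dirDeriv_pairing_smul_left hg hU hp hf hZ hX,
    dirDeriv_pairing_smul_right hg hU hp hf hZ hY]
  simp only [Pi.smul_apply', dirDeriv_smul_vector,
    lieBracket_smul_right hf hZ, map_add, add_apply,
    map_smul, smul_apply, smul_eq_mul]
  rw [hg.symm p hp (Y p) (Z p)]
  ring

theorem koszul_add_middle (hg : IsMetricOn g U) (hU : IsOpen U) (hp : p ∈ U)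
    (hX : DiffAt X p) (hY : DiffAt Y p) (hY' : DiffAt Y' p) (hZ : DiffAt Z p) :
    koszul g X (Y + Y') Z p = koszul g X Y Z p + koszul g X Y' Z p := by
  simp only [koszul, dirDeriv_pairing_add_left hg hU hp hY hY' hZ,
    dirDeriv_pairing_add_right hg hU hp hY hY' hX]
  simp only [Pi.add_apply, dirDeriv_add_vector,
    VectorField.mlieBracket_add_right hY hY', VectorField.mlieBracket_add_left hY hY',
    map_add, add_apply]
  ring

theorem koszul_smul_middle (hg : IsMetricOn g U) (hU : IsOpen U) (hp : p ∈ U)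
    (hf : MDifferentiableAt (𝓡 d) 𝓘(ℝ) f p)
    (hX : DiffAt X p) (hY : DiffAt Y p) (hZ : DiffAt Z p) :
    koszul g X (f • Y) Z p = f p * koszul g X Y Z p + dirDeriv f p (X p) * g p (Y p) (Z p) := by
  simp only [koszul, dirDeriv_pairing_smul_left hg hU hp hf hY hZ,
    dirDeriv_pairing_smul_right hg hU hp hf hY hX]
  simp only [Pi.smul_apply', dirDeriv_smul_vector,
    lieBracket_smul_right hf hY, lieBracket_smul_left hf hY, map_add,
    add_apply, map_smul, smul_apply, smul_eq_mul]
  rw [hg.symm p hp (X p) (Y p)]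
  ring

theorem koszul_add_left (hg : IsMetricOn g U) (hU : IsOpen U) (hp : p ∈ U)
    (hX : DiffAt X p) (hX' : DiffAt X' p) (hY : DiffAt Y p) (hZ : DiffAt Z p) :
    koszul g (X + X') Y Z p = koszul g X Y Z p + koszul g X' Y Z p := by
  simp only [koszul, dirDeriv_pairing_add_left hg hU hp hX hX' hY,
    dirDeriv_pairing_add_right hg hU hp hX hX' hZ]
  simp only [Pi.add_apply, dirDeriv_add_vector,
    VectorField.mlieBracket_add_left hX hX', map_add, add_apply]
  ring

theorem koszul_smul_left (hg : IsMetricOn g U) (hU : IsOpen U) (hp : p ∈ U)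
    (hf : MDifferentiableAt (𝓡 d) 𝓘(ℝ) f p)
    (hX : DiffAt X p) (hY : DiffAt Y p) (hZ : DiffAt Z p) :
    koszul g (f • X) Y Z p = f p * koszul g X Y Z p := by
  simp only [koszul, dirDeriv_pairing_smul_left hg hU hp hf hX hY,
    dirDeriv_pairing_smul_right hg hU hp hf hX hZ]
  simp only [Pi.smul_apply', dirDeriv_smul_vector,
    lieBracket_smul_left hf hX, map_add, add_apply,
    map_smul, smul_apply, smul_eq_mul]
  rw [hg.symm p hp (X p) (Z p)]
  ring

/-- The derivatives of a factor on Z coming from the pairings cancel those coming from the brackets.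
So the Koszul expression is a linear form in Z(p), and the Riesz representation provides the vector
∇_X Y at p. -/
theorem koszul_tensorialAt_right (hg : IsMetricOn g U) (hU : IsOpen U) (hp : p ∈ U)
    (hX : DiffAt X p) (hY : DiffAt Y p) :
    TensorialAt (𝓡 d) (EuclideanSpace ℝ (Fin d)) (fun Z : VField d M => koszul g X Y Z p) p where
  smul hf hZ := koszul_smul_right hg hU hp hf hX hY hZ
  add hZ hZ' := koszul_add_right hg hU hp hX hY hZ hZ'

theorem koszul_congr (hX : X =ᶠ[𝓝 p] X') (hY : Y =ᶠ[𝓝 p] Y') (Z : VField d M) :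
    koszul g X Y Z p = koszul g X' Y' Z p := by
  simp only [koszul, hX.self_of_nhds, hY.self_of_nhds, hX.mlieBracket_vectorField_eq hY,
    hX.mlieBracket_vectorField_eq (Filter.EventuallyEq.refl _ Z),
    hY.mlieBracket_vectorField_eq (Filter.EventuallyEq.refl _ Z)]
  rw [dirDeriv_congr (X' p) (f' := fun q => g q (Y' q) (Z q)) (hY.mono fun q hq => by simp [hq]),
    dirDeriv_congr (Y' p) (f' := fun q => g q (Z q) (X' q)) (hX.mono fun q hq => by simp [hq]),
    dirDeriv_congr (Z p) (f' := fun q => g q (X' q) (Y' q))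
      (by filter_upwards [hX, hY] with q hq hq'; simp [hq, hq'])]

/-- Metric compatibility of ∇, at the level of the Koszul expression. -/
theorem koszul_add_koszul_swap (hg : IsMetricOn g U) (hU : IsOpen U) (hp : p ∈ U)
    (X Y Z : VField d M) :
    koszul g X Y Z p + koszul g X Z Y p = dirDeriv (fun q => g q (Y q) (Z q)) p (X p) := by
  have h : VectorField.mlieBracket (𝓡 d) Z Y p = -VectorField.mlieBracket (𝓡 d) Y Z p :=
    VectorField.mlieBracket_swap_apply
  simp only [koszul, h, map_neg, neg_apply]
  rw [dirDeriv_pairing_symm hg hU hp Z X, dirDeriv_pairing_symm hg hU hp Y X,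
    dirDeriv_pairing_symm hg hU hp Z Y]
  ring

/-- Vanishing torsion of ∇, at the level of the Koszul expression. -/
theorem koszul_sub_koszul_swap (hg : IsMetricOn g U) (hU : IsOpen U) (hp : p ∈ U)
    (X Y Z : VField d M) :
    koszul g X Y Z p - koszul g Y X Z p = g p (VectorField.mlieBracket (𝓡 d) X Y p) (Z p) := by
  have h : VectorField.mlieBracket (𝓡 d) Y X p = -VectorField.mlieBracket (𝓡 d) X Y p :=
    VectorField.mlieBracket_swap_apply
  simp only [koszul, h, map_neg, neg_apply]
  rw [dirDeriv_pairing_symm hg hU hp Z X, dirDeriv_pairing_symm hg hU hp Y X,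
    dirDeriv_pairing_symm hg hU hp Z Y]
  ring

end Koszul

section LeviCivita

variable {f : M → ℝ} {X X' Y Y' Z Z' : VField d M}

theorem pairing_leviCivita (hg : IsMetricOn g U) (hU : IsOpen U) (hp : p ∈ U)
    (hX : DiffAt X p) (hY : DiffAt Y p) (hZ : DiffAt Z p) :
    g p (leviCivita g X Y p) (Z p) = koszul g X Y Z p := by
  have hT := koszul_tensorialAt_right hg hU hp hX hY
  have hex : ∃ v : TangentSpace (𝓡 d) p, ∀ Z : VField d M, DiffAt Z p →
      g p v (Z p) = koszul g X Y Z p := by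
    obtain ⟨v, hv⟩ := hg.exists_riesz hp (hT.mkHom).toLinearMap
    exact ⟨v, fun Z hZ => (hv (Z p)).trans (hT.mkHom_apply hZ)⟩
  rw [leviCivita, dif_pos hex]
  exact hex.choose_spec Z hZ

/-- Two tangent vectors agree when they have the same products with all differentiable fields. -/
theorem IsMetricOn.eq_of_forall_field (hg : IsMetricOn g U) (hp : p ∈ U)
    {v w : TangentSpace (𝓡 d) p} (h : ∀ Z : VField d M, DiffAt Z p → g p v (Z p) = g p w (Z p)) :
    v = w :=
  hg.eq_of_pairing_eq hp fun z => by
    simpa using h (FiberBundle.extend (EuclideanSpace ℝ (Fin d)) z) (diffAt_extend z)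

theorem leviCivita_eq (hg : IsMetricOn g U) (hU : IsOpen U) (hp : p ∈ U)
    (hX : DiffAt X p) (hY : DiffAt Y p) {v : TangentSpace (𝓡 d) p}
    (h : ∀ Z : VField d M, DiffAt Z p → g p v (Z p) = koszul g X Y Z p) :
    leviCivita g X Y p = v :=
  hg.eq_of_forall_field hp fun Z hZ => by
    rw [pairing_leviCivita hg hU hp hX hY hZ, h Z hZ]

theorem leviCivita_add_right (hg : IsMetricOn g U) (hU : IsOpen U) (hp : p ∈ U)
    (hX : DiffAt X p) (hY : DiffAt Y p) (hY' : DiffAt Y' p) :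
    leviCivita g X (Y + Y') p = leviCivita g X Y p + leviCivita g X Y' p :=
  leviCivita_eq hg hU hp hX (hY.add hY') fun Z hZ => by
    rw [koszul_add_middle hg hU hp hX hY hY' hZ, map_add, add_apply,
      pairing_leviCivita hg hU hp hX hY hZ, pairing_leviCivita hg hU hp hX hY' hZ]

theorem leviCivita_smul_right (hg : IsMetricOn g U) (hU : IsOpen U) (hp : p ∈ U)
    (hf : MDifferentiableAt (𝓡 d) 𝓘(ℝ) f p) (hX : DiffAt X p) (hY : DiffAt Y p) :
    leviCivita g X (f • Y) p = f p • leviCivita g X Y p + dirDeriv f p (X p) • Y p :=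
  leviCivita_eq hg hU hp hX (hY.smul hf) fun Z hZ => by
    rw [koszul_smul_middle hg hU hp hf hX hY hZ, map_add, add_apply,
      map_smul, map_smul, smul_apply, smul_apply,
      pairing_leviCivita hg hU hp hX hY hZ, smul_eq_mul, smul_eq_mul]

theorem leviCivita_add_left (hg : IsMetricOn g U) (hU : IsOpen U) (hp : p ∈ U)
    (hX : DiffAt X p) (hX' : DiffAt X' p) (hY : DiffAt Y p) :
    leviCivita g (X + X') Y p = leviCivita g X Y p + leviCivita g X' Y p :=
  leviCivita_eq hg hU hp (hX.add hX') hY fun Z hZ => by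
    rw [koszul_add_left hg hU hp hX hX' hY hZ, map_add, add_apply,
      pairing_leviCivita hg hU hp hX hY hZ, pairing_leviCivita hg hU hp hX' hY hZ]

theorem leviCivita_smul_left (hg : IsMetricOn g U) (hU : IsOpen U) (hp : p ∈ U)
    (hf : MDifferentiableAt (𝓡 d) 𝓘(ℝ) f p) (hX : DiffAt X p) (hY : DiffAt Y p) :
    leviCivita g (f • X) Y p = f p • leviCivita g X Y p :=
  leviCivita_eq hg hU hp (hX.smul hf) hY fun Z hZ => by
    rw [koszul_smul_left hg hU hp hf hX hY hZ, map_smul, smul_apply,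
      pairing_leviCivita hg hU hp hX hY hZ, smul_eq_mul]

theorem leviCivita_congr (hX : X =ᶠ[𝓝 p] X') (hY : Y =ᶠ[𝓝 p] Y') :
    leviCivita g X Y p = leviCivita g X' Y' p := by
  classical
  -- No regularity of the fields is assumed, so uniqueness of the vector is not available. The two
  -- defining predicates are equal, hence so are the chosen values, default included.
  have hP : (fun v : TangentSpace (𝓡 d) p => ∀ Z : VField d M, DiffAt Z p →
        g p v (Z p) = koszul g X Y Z p) =
      fun v => ∀ Z : VField d M, DiffAt Z p → g p v (Z p) = koszul g X' Y' Z p := by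
    simp only [koszul_congr hX hY]
  unfold leviCivita
  convert congrArg (fun P : TangentSpace (𝓡 d) p → Prop =>
    if h : ∃ v, P v then h.choose else 0) hP

theorem pairing_leviCivita_add (hg : IsMetricOn g U) (hU : IsOpen U) (hp : p ∈ U)
    (hX : DiffAt X p) (hY : DiffAt Y p) (hZ : DiffAt Z p) :
    g p (leviCivita g X Y p) (Z p) + g p (Y p) (leviCivita g X Z p) =
      dirDeriv (fun q => g q (Y q) (Z q)) p (X p) := by
  rw [hg.symm p hp (Y p), pairing_leviCivita hg hU hp hX hY hZ,
    pairing_leviCivita hg hU hp hX hZ hY, koszul_add_koszul_swap hg hU hp]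

theorem leviCivita_sub_swap (hg : IsMetricOn g U) (hU : IsOpen U) (hp : p ∈ U)
    (hX : DiffAt X p) (hY : DiffAt Y p) :
    leviCivita g X Y p - leviCivita g Y X p = VectorField.mlieBracket (𝓡 d) X Y p :=
  hg.eq_of_forall_field hp fun Z hZ => by
    rw [map_sub, sub_apply, pairing_leviCivita hg hU hp hX hY hZ,
      pairing_leviCivita hg hU hp hY hX hZ, koszul_sub_koszul_swap hg hU hp]

end LeviCivita

end LeviCivita

/-! ### Smoothness of the Levi-Civita connection. -/

section Smoothness

section Matrix

variable {d : ℕ} {M : Type*} [TopologicalSpace M] [ChartedSpace (EuclideanSpace ℝ (Fin d)) M]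

theorem contMDiffOn_matrix_det {ι : Type*} [Fintype ι] [DecidableEq ι] {A : M → Matrix ι ι ℝ}
    {U : Set M} (hA : ∀ i j, ContMDiffOn (𝓡 d) 𝓘(ℝ) ∞ (fun q => A q i j) U) :
    ContMDiffOn (𝓡 d) 𝓘(ℝ) ∞ (fun q => (A q).det) U := by
  simp only [Matrix.det_apply']
  exact contMDiffOn_finsetSum fun σ _ => contMDiffOn_const.mul
    (contMDiffOn_finsetProd fun i _ => hA (σ i) i)

end Matrix

variable {d : ℕ} {M : Type*} [TopologicalSpace M] [ChartedSpace (EuclideanSpace ℝ (Fin d)) M]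
  [IsManifold (𝓡 d) ∞ M] {g : FormField d M} {J : EndField d M} {U : Set M} {p : M}
  {X Y Z : VField d M}

theorem SmoothOn.contMDiffOn_dirDeriv (hX : SmoothOn X U) (hU : IsOpen U) {f : M → ℝ}
    (hf : ContMDiffOn (𝓡 d) 𝓘(ℝ) ∞ f U) :
    ContMDiffOn (𝓡 d) 𝓘(ℝ) ∞ (fun q => dirDeriv f q (X q)) U := by
  have h1 := hf.contMDiffOn_tangentMapWithin (m := ∞) (by simp) hU.uniqueMDiffOn
  have h2 := (contMDiff_snd_tangentBundle_modelSpace (n := ∞) ℝ 𝓘(ℝ)).comp_contMDiffOn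
    (h1.comp hX fun q hq => hq)
  refine h2.congr fun q hq => ?_
  change dirDeriv f q (X q) = mfderivWithin (𝓡 d) 𝓘(ℝ) f U q (X q)
  rw [mfderivWithin_of_isOpen hU hq]
  rfl

theorem SmoothOn.lieBracket (hX : SmoothOn X U) (hY : SmoothOn Y U) (hU : IsOpen U) :
    SmoothOn (VectorField.mlieBracket (𝓡 d) X Y) U := by
  have : IsManifold (𝓡 d) ((∞ : ℕ∞ω) + 1) M := by simpa
  have : IsManifold (𝓡 d) (minSmoothness ℝ 2) M := by
    rw [minSmoothness_of_isRCLikeNormedField]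
    infer_instance
  intro q hq
  have hX' := (hX.contMDiffAt (hU.mem_nhds hq))
  have hY' := (hY.contMDiffAt (hU.mem_nhds hq))
  exact (ContMDiffAt.mlieBracket_vectorField (n := ⊤) (m := ⊤) hX' hY'
    (by simp)).contMDiffWithinAt

theorem IsMetricOn.contMDiffOn_koszul (hg : IsMetricOn g U) (hU : IsOpen U) (hX : SmoothOn X U)
    (hY : SmoothOn Y U) (hZ : SmoothOn Z U) :
    ContMDiffOn (𝓡 d) 𝓘(ℝ) ∞ (koszul g X Y Z) U := by
  have hXY := hg.contMDiffOn_pairing hX hY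
  have hYZ := hg.contMDiffOn_pairing hY hZ
  have hZX := hg.contMDiffOn_pairing hZ hX
  exact contMDiffOn_const.mul ((((((hX.contMDiffOn_dirDeriv hU hYZ).add
    (hY.contMDiffOn_dirDeriv hU hZX)).sub (hZ.contMDiffOn_dirDeriv hU hXY)).add
    (hg.contMDiffOn_pairing (hX.lieBracket hY hU) hZ)).sub
    (hg.contMDiffOn_pairing (hX.lieBracket hZ hU) hY)).sub
    (hg.contMDiffOn_pairing (hY.lieBracket hZ hU) hX))

theorem IsMetricOn.mono (hg : IsMetricOn g U) {V : Set M} (h : V ⊆ U) : IsMetricOn g V :=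
  ⟨hg.contMDiffOn.mono h, fun q hq => hg.symm q (h hq), fun q hq => hg.pos q (h hq)⟩

theorem SmoothOn.mono (hX : SmoothOn X U) {V : Set M} (h : V ⊆ U) : SmoothOn X V :=
  ContMDiffOn.mono hX h

/-- The local frame of the tangent bundle given by the trivialization at `p`. -/
def tangentFrame (p : M) (i : Fin d) : VField d M :=
  (trivializationAt (EuclideanSpace ℝ (Fin d)) (TangentSpace (𝓡 d)) p).localFrame
    (EuclideanSpace.basisFun (Fin d) ℝ).toBasis i

/-- The neighbourhood of `p` on which `tangentFrame p` is a frame. -/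
def frameDomain (d : ℕ) {M : Type*} [TopologicalSpace M]
    [ChartedSpace (EuclideanSpace ℝ (Fin d)) M] [IsManifold (𝓡 d) ∞ M] (p : M) : Set M :=
  (trivializationAt (EuclideanSpace ℝ (Fin d)) (TangentSpace (𝓡 d) : M → Type _) p).baseSet

theorem isOpen_frameDomain : IsOpen (frameDomain d p) := Trivialization.open_baseSet _

theorem mem_frameDomain : p ∈ frameDomain d p := FiberBundle.mem_baseSet_trivializationAt _ _ p

theorem isLocalFrameOn_tangentFrame (p : M) :
    IsLocalFrameOn (𝓡 d) (EuclideanSpace ℝ (Fin d)) ∞ (tangentFrame p : Fin d → VField d M)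
      (frameDomain d p) :=
  Trivialization.isLocalFrameOn_localFrame_baseSet _ _ _ _

theorem smoothOn_tangentFrame (p : M) (i : Fin d) :
    SmoothOn (tangentFrame p i : VField d M) (frameDomain d p) :=
  (isLocalFrameOn_tangentFrame p).contMDiffOn i

/-- Coefficients of tangent vectors in `tangentFrame p`. -/
def frameCoeff (p : M) (i : Fin d) (q : M) : TangentSpace (𝓡 d) q →ₗ[ℝ] ℝ :=
  (isLocalFrameOn_tangentFrame (d := d) p).coeff i q

theorem sum_frameCoeff {q : M} (hq : q ∈ frameDomain d p) (v : TangentSpace (𝓡 d) q) :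
    ∑ i, frameCoeff p i q v • tangentFrame p i q = v := by
  simpa [frameCoeff, IsLocalFrameOn.coeff, hq] using
    ((isLocalFrameOn_tangentFrame p).toBasisAt hq).sum_repr v

theorem contMDiffOn_frameCoeff (hU : IsOpen U) (hUp : U ⊆ frameDomain d p) (hX : SmoothOn X U)
    (i : Fin d) : ContMDiffOn (𝓡 d) 𝓘(ℝ) ∞ (fun q => frameCoeff p i q (X q)) U :=
  contMDiffOn_localFrameCoeff _ hU hUp hX i

theorem mdifferentiableAt_frameCoeff (hX : DiffAt X p) (i : Fin d) :
    MDifferentiableAt (𝓡 d) 𝓘(ℝ) (fun q => frameCoeff p i q (X q)) p :=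
  mdifferentiableAt_localFrameCoeff _ mem_frameDomain hX i

theorem linearIndependent_tangentFrame {q : M} (hq : q ∈ frameDomain d p) :
    LinearIndependent ℝ fun i => (tangentFrame p i q : TangentSpace (𝓡 d) q) :=
  (isLocalFrameOn_tangentFrame p).linearIndependent hq

/-- A vector field is smooth when its products with the fields of a local frame are. -/
theorem IsMetricOn.smoothOn_of_pairing_frame (hg : IsMetricOn g U) (hU : U ⊆ frameDomain d p)
    {V : VField d M}
    (hV : ∀ i, ContMDiffOn (𝓡 d) 𝓘(ℝ) ∞ (fun q => g q (V q) (tangentFrame p i q)) U) :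
    SmoothOn V U := by
  have hs : ∀ i, SmoothOn (tangentFrame p i : VField d M) U := fun i =>
    (smoothOn_tangentFrame p i).mono hU
  let G : M → Matrix (Fin d) (Fin d) ℝ := fun q =>
    Matrix.of fun i j => g q (tangentFrame p i q) (tangentFrame p j q)
  let r : M → Fin d → ℝ := fun q i => g q (V q) (tangentFrame p i q)
  let c : M → Fin d → ℝ := fun q i => frameCoeff p i q (V q)
  have hG : ∀ i j, ContMDiffOn (𝓡 d) 𝓘(ℝ) ∞ (fun q => G q i j) U := fun i j =>
    hg.contMDiffOn_pairing (hs i) (hs j)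
  -- A kernel vector of the Gram matrix gives a combination of the frame orthogonal to every vector,
  -- hence zero.
  have hdet : ∀ q ∈ U, (G q).det ≠ 0 := by
    intro q hq h0
    obtain ⟨v, hv0, hv⟩ := Matrix.exists_mulVec_eq_zero_iff.2 h0
    let w : TangentSpace (𝓡 d) q := ∑ j, v j • tangentFrame p j q
    have hw : w = 0 := hg.eq_of_pairing_eq hq fun z => by
      rw [← sum_frameCoeff (hU hq) z]
      simp only [map_sum, map_smul, map_zero, zero_apply, smul_zero, Finset.sum_const_zero]
      refine Finset.sum_eq_zero fun i _ => ?_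
      have := congrFun hv i
      simp only [Matrix.mulVec, dotProduct, G, Matrix.of_apply, Pi.zero_apply] at this
      simp only [w, map_sum, map_smul, sum_apply, smul_apply, smul_eq_mul]
      rw [mul_eq_zero]
      right
      rw [← this]
      exact Finset.sum_congr rfl fun j _ => by rw [hg.symm q hq, mul_comm]
    exact hv0 (funext fun i =>
      Fintype.linearIndependent_iff.1 (linearIndependent_tangentFrame (hU hq)) v hw i)
  have hGc : ∀ q ∈ U, (G q).mulVec (c q) = r q := by
    intro q hq
    ext i
    have h : g q (V q) (tangentFrame p i q) =
        g q (∑ j, c q j • tangentFrame p j q) (tangentFrame p i q) := by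
      rw [sum_frameCoeff (hU hq)]
    simp only [r, h, Matrix.mulVec, dotProduct, G, Matrix.of_apply, map_sum, map_smul, sum_apply,
      smul_apply, smul_eq_mul]
    exact Finset.sum_congr rfl fun j _ => by rw [hg.symm q hq, mul_comm]
  have hc : ∀ i, ContMDiffOn (𝓡 d) 𝓘(ℝ) ∞ (fun q => c q i) U := by
    intro i
    -- Cramer's rule: the coefficients of `V` solve the Gram system, so they are quotients of
    -- determinants with smooth entries.
    have h : ContMDiffOn (𝓡 d) 𝓘(ℝ) ∞
        (fun q => ((G q).updateCol i (r q)).det / (G q).det) U := by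
      refine ContMDiffOn.div₀ (contMDiffOn_matrix_det fun k l => ?_) (contMDiffOn_matrix_det hG) hdet
      by_cases hl : l = i
      · subst hl
        simpa using hV k
      · simpa [Matrix.updateCol_apply, hl] using hG k l
    refine h.congr fun q hq => ?_
    rw [eq_div_iff (hdet q hq), ← Matrix.cramer_apply, ← hGc q hq, Matrix.cramer_eq_adjugate_mulVec,
      Matrix.mulVec_mulVec, Matrix.adjugate_mul, Matrix.smul_mulVec, Matrix.one_mulVec,
      Pi.smul_apply, smul_eq_mul, mul_comm]
  have hsum : SmoothOn (fun q => ∑ i, c q i • tangentFrame p i q) U :=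
    ContMDiffOn.sum_section fun i _ => (hc i).smul_section (hs i)
  refine ContMDiffOn.congr hsum fun q hq => ?_
  simp only [c, sum_frameCoeff (hU hq)]

theorem SmoothOn.of_locally (h : ∀ p ∈ U, SmoothOn X (U ∩ frameDomain d p)) : SmoothOn X U :=
  contMDiffOn_of_locally_contMDiffOn fun p hp =>
    ⟨frameDomain d p, isOpen_frameDomain, mem_frameDomain, h p hp⟩

theorem IsMetricOn.smoothOn_leviCivita (hg : IsMetricOn g U) (hU : IsOpen U) (hX : SmoothOn X U)
    (hY : SmoothOn Y U) : SmoothOn (leviCivita g X Y) U := by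
  refine SmoothOn.of_locally fun p _ => ?_
  have hU' : IsOpen (U ∩ frameDomain d p) := hU.inter isOpen_frameDomain
  have hg' := hg.mono (V := U ∩ frameDomain d p) inter_subset_left
  have hX' := hX.mono (V := U ∩ frameDomain d p) inter_subset_left
  have hY' := hY.mono (V := U ∩ frameDomain d p) inter_subset_left
  refine hg'.smoothOn_of_pairing_frame inter_subset_right fun i => ?_
  have hs := (smoothOn_tangentFrame p i).mono (V := U ∩ frameDomain d p) inter_subset_right
  refine (hg'.contMDiffOn_koszul hU' hX' hY' hs).congr fun q hq => ?_
  exact pairing_leviCivita hg' hU' hq (hX'.diffAt hU' hq) (hY'.diffAt hU' hq) (hs.diffAt hU' hq)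

end Smoothness

/-! ### The canonical connection and the tensor h. -/

section SecondFundamental

variable {d : ℕ} {M : Type*} [TopologicalSpace M] [ChartedSpace (EuclideanSpace ℝ (Fin d)) M]
  [IsManifold (𝓡 d) ∞ M] {g : FormField d M} {J : EndField d M} {U : Set M} {p : M}
  {X X' Y Y' Z : VField d M} {f : M → ℝ}

theorem applyEnd_add (J : EndField d M) (X Y : VField d M) :
    applyEnd J (X + Y) = applyEnd J X + applyEnd J Y := by
  funext q; simp [applyEnd]

theorem applyEnd_smul (J : EndField d M) (f : M → ℝ) (X : VField d M) :
    applyEnd J (f • X) = f • applyEnd J X := by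
  funext q; simp [applyEnd]

theorem leviCivita_neg_right (hg : IsMetricOn g U) (hU : IsOpen U) (hp : p ∈ U)
    (hX : DiffAt X p) (hY : DiffAt Y p) : leviCivita g X (-Y) p = -leviCivita g X Y p := by
  have h : -Y = (fun _ : M => (-1 : ℝ)) • Y := by funext q; simp
  have h0 : dirDeriv (fun _ : M => (-1 : ℝ)) p (X p) = 0 := by
    rw [dirDeriv, mvfderiv_const]
    rfl
  rw [h, leviCivita_smul_right hg hU hp mdifferentiableAt_const hX hY, h0]
  simp

namespace IsAlmostHermitianOn

theorem skew (h : IsAlmostHermitianOn g J U) (hp : p ∈ U) (x y : TangentSpace (𝓡 d) p) :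
    g p (J p x) y = -g p x (J p y) := by
  rw [← h.compatible p hp (J p x) y, h.sq p hp, map_neg, neg_apply]

theorem applyEnd_applyEnd (h : IsAlmostHermitianOn g J U) (hU : IsOpen U) (hp : p ∈ U)
    (Y : VField d M) : applyEnd J (applyEnd J Y) =ᶠ[𝓝 p] -Y :=
  Filter.eventuallyEq_of_mem (hU.mem_nhds hp) fun q hq => h.sq q hq (Y q)

theorem leviCivita_applyEnd_applyEnd (h : IsAlmostHermitianOn g J U) (hU : IsOpen U) (hp : p ∈ U)
    (hX : DiffAt X p) (hY : DiffAt Y p) :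
    leviCivita g X (applyEnd J (applyEnd J Y)) p = -leviCivita g X Y p := by
  rw [leviCivita_congr (Filter.EventuallyEq.refl _ X) (h.applyEnd_applyEnd hU hp Y),
    leviCivita_neg_right h.isMetricOn hU hp hX hY]

theorem canonicalConnection_applyEnd (h : IsAlmostHermitianOn g J U) (hU : IsOpen U) (hp : p ∈ U)
    (hX : DiffAt X p) (hY : DiffAt Y p) :
    canonicalConnection g J X (applyEnd J Y) p = J p (canonicalConnection g J X Y p) := by
  simp only [canonicalConnection, h.leviCivita_applyEnd_applyEnd hU hp hX hY, map_smul, map_sub,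
    map_neg, h.sq p hp]
  module

/-- ∇̄ is the average of ∇ and of -J∇J = J⁻¹∇J, the conjugate of ∇ by the isometry J. Both preserve
the metric, hence so does their average. -/
theorem pairing_canonicalConnection_add (h : IsAlmostHermitianOn g J U) (hU : IsOpen U)
    (hp : p ∈ U) (hX : DiffAt X p) (hY : DiffAt Y p) (hZ : DiffAt Z p) :
    g p (canonicalConnection g J X Y p) (Z p) + g p (Y p) (canonicalConnection g J X Z p) =
      dirDeriv (fun q => g q (Y q) (Z q)) p (X p) := by
  have hg := h.isMetricOn
  have h1 := pairing_leviCivita_add hg hU hp hX hY hZ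
  have h2 := pairing_leviCivita_add hg hU hp hX (h.diffAt_applyEnd hU hp hY)
    (h.diffAt_applyEnd hU hp hZ)
  have h3 : dirDeriv (fun q => g q (applyEnd J Y q) (applyEnd J Z q)) p (X p) =
      dirDeriv (fun q => g q (Y q) (Z q)) p (X p) :=
    dirDeriv_congr _ (Filter.eventuallyEq_of_mem (hU.mem_nhds hp)
      fun q hq => h.compatible q hq _ _)
  have h4 := h.skew hp (leviCivita g X (applyEnd J Y) p) (Z p)
  have h5 := h.skew hp (Y p) (leviCivita g X (applyEnd J Z) p)
  simp only [canonicalConnection, map_smul, map_sub, smul_apply, sub_apply, smul_eq_mul]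
  simp only [applyEnd] at h2 h3 h4 h5 ⊢
  linarith

theorem secondFundamental_eq (g : FormField d M) (J : EndField d M) (X Y : VField d M) (p : M) :
    secondFundamental g J X Y p =
      (1 / 2 : ℝ) • (leviCivita g X Y p + J p (leviCivita g X (applyEnd J Y) p)) := by
  simp only [secondFundamental, canonicalConnection]
  module

theorem secondFundamental_tensorialAt_left (h : IsAlmostHermitianOn g J U) (hU : IsOpen U)
    (hp : p ∈ U) (hY : DiffAt Y p) :
    TensorialAt (𝓡 d) (EuclideanSpace ℝ (Fin d))
      (fun X : VField d M => secondFundamental g J X Y p) p where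
  smul {f X} hf hX := by
    simp only [secondFundamental_eq, leviCivita_smul_left h.isMetricOn hU hp hf hX hY,
      leviCivita_smul_left h.isMetricOn hU hp hf hX (h.diffAt_applyEnd hU hp hY), map_smul]
    module
  add {X X'} hX hX' := by
    simp only [secondFundamental_eq, leviCivita_add_left h.isMetricOn hU hp hX hX' hY,
      leviCivita_add_left h.isMetricOn hU hp hX hX' (h.diffAt_applyEnd hU hp hY), map_add]
    module

theorem secondFundamental_tensorialAt_right (h : IsAlmostHermitianOn g J U) (hU : IsOpen U)
    (hp : p ∈ U) (hX : DiffAt X p) :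
    TensorialAt (𝓡 d) (EuclideanSpace ℝ (Fin d))
      (fun Y : VField d M => secondFundamental g J X Y p) p where
  smul {f Y} hf hY := by
    simp only [secondFundamental_eq, applyEnd_smul,
      leviCivita_smul_right h.isMetricOn hU hp hf hX hY,
      leviCivita_smul_right h.isMetricOn hU hp hf hX (h.diffAt_applyEnd hU hp hY), map_add,
      map_smul]
    -- The derivative terms are df(X) Y and J(df(X) JY) = -df(X) Y; they cancel because J² = -1.
    rw [show J p (applyEnd J Y p) = -Y p from h.sq p hp (Y p)]
    module
  add {Y Y'} hY hY' := by
    simp only [secondFundamental_eq, applyEnd_add,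
      leviCivita_add_right h.isMetricOn hU hp hX hY hY',
      leviCivita_add_right h.isMetricOn hU hp hX (h.diffAt_applyEnd hU hp hY)
        (h.diffAt_applyEnd hU hp hY'), map_add]
    module

/-- The tensor `h` computes the second fundamental field of differentiable vector fields. -/
theorem pairing_secondFundamental (h : IsAlmostHermitianOn g J U) (hU : IsOpen U) (hp : p ∈ U)
    (hX : DiffAt X p) (hY : DiffAt Y p) (z : TangentSpace (𝓡 d) p) :
    g p (secondFundamental g J X Y p) z = secondFundamentalAt g J p (X p) (Y p) z := by
  rw [secondFundamentalAt, TensorialAt.pointwise₂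
    (Φ := fun X Y : VField d M => secondFundamental g J X Y p)
    (fun Y hY => h.secondFundamental_tensorialAt_left hU hp hY)
    (fun X hX => h.secondFundamental_tensorialAt_right hU hp hX)
    hX (diffAt_extend (X p)) hY (diffAt_extend (Y p)) (by simp) (by simp)]

theorem canonicalConnection_add_right (h : IsAlmostHermitianOn g J U) (hU : IsOpen U) (hp : p ∈ U)
    (hX : DiffAt X p) (hY : DiffAt Y p) (hY' : DiffAt Y' p) :
    canonicalConnection g J X (Y + Y') p =
      canonicalConnection g J X Y p + canonicalConnection g J X Y' p := by
  simp only [canonicalConnection, applyEnd_add,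
    leviCivita_add_right h.isMetricOn hU hp hX hY hY',
    leviCivita_add_right h.isMetricOn hU hp hX (h.diffAt_applyEnd hU hp hY)
      (h.diffAt_applyEnd hU hp hY'), map_add]
  module

theorem canonicalConnection_smul_right (h : IsAlmostHermitianOn g J U) (hU : IsOpen U) (hp : p ∈ U)
    (hf : MDifferentiableAt (𝓡 d) 𝓘(ℝ) f p) (hX : DiffAt X p) (hY : DiffAt Y p) :
    canonicalConnection g J X (f • Y) p =
      f p • canonicalConnection g J X Y p + dirDeriv f p (X p) • Y p := by
  simp only [canonicalConnection, applyEnd_smul,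
    leviCivita_smul_right h.isMetricOn hU hp hf hX hY,
    leviCivita_smul_right h.isMetricOn hU hp hf hX (h.diffAt_applyEnd hU hp hY), map_add, map_smul]
  rw [show J p (applyEnd J Y p) = -Y p from h.sq p hp (Y p)]
  module

theorem smoothOn_canonicalConnection (h : IsAlmostHermitianOn g J U) (hU : IsOpen U)
    (hX : SmoothOn X U) (hY : SmoothOn Y U) : SmoothOn (canonicalConnection g J X Y) U :=
  ContMDiffOn.const_smul_section (ContMDiffOn.sub_section
    (h.isMetricOn.smoothOn_leviCivita hU hX hY)
    (h.smoothOn_applyEnd (h.isMetricOn.smoothOn_leviCivita hU hX (h.smoothOn_applyEnd hY))))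

theorem smoothOn_secondFundamental (h : IsAlmostHermitianOn g J U) (hU : IsOpen U)
    (hX : SmoothOn X U) (hY : SmoothOn Y U) : SmoothOn (secondFundamental g J X Y) U :=
  ContMDiffOn.sub_section (h.isMetricOn.smoothOn_leviCivita hU hX hY)
    (h.smoothOn_canonicalConnection hU hX hY)

/-- Torsion of the canonical connection. -/
theorem canonicalConnection_sub_swap (h : IsAlmostHermitianOn g J U) (hU : IsOpen U) (hp : p ∈ U)
    (hX : DiffAt X p) (hY : DiffAt Y p) :
    canonicalConnection g J X Y p - canonicalConnection g J Y X p =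
      VectorField.mlieBracket (𝓡 d) X Y p - secondFundamental g J X Y p +
        secondFundamental g J Y X p := by
  rw [← leviCivita_sub_swap h.isMetricOn hU hp hX hY]
  simp only [secondFundamental]
  module

end IsAlmostHermitianOn

end SecondFundamental

/-! ### Linear algebra of the type U₄ tensor. -/

section LeeTensor

section LinearAlgebra

variable {V : Type*} [AddCommGroup V] [Module ℝ V]

/-- The trilinear form
`⟨x,y⟩ α(z) - ⟨x,z⟩ α(y) - ⟨x,Jy⟩ α(Jz) + ⟨x,Jz⟩ α(Jy)` attached to a linear form `α`. -/
def leeTensor (g : V → V → ℝ) (J : V → V) (α : V → ℝ) (x y z : V) : ℝ :=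
  g x y * α z - g x z * α y - g x (J y) * α (J z) + g x (J z) * α (J y)

variable {B : V →ₗ[ℝ] V →ₗ[ℝ] ℝ} {J : V →ₗ[ℝ] V}

theorem bilin_skew (hJ : ∀ x, J (J x) = -x) (hB : ∀ x y, B (J x) (J y) = B x y) (x y : V) :
    B (J x) y = -B x (J y) := by
  rw [← hB (J x) y, hJ, map_neg, LinearMap.neg_apply]

/-- An element of `𝒯₄` is half the tensor attached to some linear form. -/
theorem exists_leeTensor_of_mem_tensorSpaceFour {n : ℕ} {g : V → V → ℝ} {J : V → V}
    {h : V →ₗ[ℝ] V →ₗ[ℝ] V →ₗ[ℝ] ℝ} (hh : h ∈ tensorSpaceFour n g J) :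
    ∃ α : V →ₗ[ℝ] ℝ, (n = 1 → α = 0) ∧ ∀ x y z, h x y z = 1 / 2 * leeTensor g J α x y z := by
  obtain ⟨-, e, -, he⟩ := hh
  refine ⟨{ toFun := fun z => 1 / ((n : ℝ) - 1) * contraction J e h z
            map_add' := fun x y => ?_
            map_smul' := fun c x => ?_ }, ?_, fun x y z => ?_⟩
  · simp only [contraction, map_add, Finset.sum_add_distrib]
    ring
  · simp only [contraction, map_smul, smul_eq_mul, ← mul_add, ← Finset.mul_sum, RingHom.id_apply]
    ring
  -- For n = 1 the coefficient is 1/0 = 0, so the form vanishes.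
  · rintro rfl
    ext
    simp
  · have h2 : (1 : ℝ) / (2 * ((n : ℝ) - 1)) = 1 / 2 * (1 / ((n : ℝ) - 1)) := by
      rw [one_div_mul_one_div]
    rw [he, h2]
    simp only [leeTensor, LinearMap.coe_mk, AddHom.coe_mk]
    ring

variable [FiniteDimensional ℝ V]

/-- Identifying V with its dual through B turns a skew J into minus its transpose, which has trace
-tr J. -/
theorem trace_eq_zero_of_skew (hpos : ∀ x, x ≠ 0 → 0 < B x x)
    (hskew : ∀ x y, B (J x) y = -B x (J y)) : LinearMap.trace ℝ V J = 0 := by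
  have hinj : Function.Injective B := by
    rw [injective_iff_map_eq_zero]
    intro v hv
    by_contra h
    simpa [hv] using hpos v h
  let Φ : V ≃ₗ[ℝ] Module.Dual ℝ V := LinearEquiv.ofBijective B
    ⟨hinj, (LinearMap.injective_iff_surjective_of_finrank_eq_finrank
      Subspace.dual_finrank_eq.symm).1 hinj⟩
  have hΦ : ∀ v z, Φ v z = B v z := fun _ _ => rfl
  have h : Φ.conj J = (-1 : ℝ) • Module.Dual.transpose (R := ℝ) J := by
    ext φ z
    obtain ⟨v, rfl⟩ := Φ.surjective φ
    simp [LinearEquiv.conj_apply, hΦ, hskew, Module.Dual.transpose_apply]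
  have h1 := LinearMap.trace_conj' J Φ
  rw [h, map_smul, LinearMap.trace_transpose', smul_eq_mul] at h1
  linarith

/-- The trace of `x ↦ h_x y` when `h` is half the tensor attached to `α`. -/
theorem trace_of_leeTensor (hsymm : ∀ x y, B x y = B y x) (hpos : ∀ x, x ≠ 0 → 0 < B x x)
    (hJ : ∀ x, J (J x) = -x) (hB : ∀ x y, B (J x) (J y) = B x y) (α : V →ₗ[ℝ] ℝ)
    (T : V →ₗ[ℝ] V) (y : V)
    (hT : ∀ x z, B (T x) z = 1 / 2 * leeTensor (fun x y => B x y) J α x y z) :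
    LinearMap.trace ℝ V T = (1 - (Module.finrank ℝ V : ℝ) / 2) * α y := by
  have hskew := bilin_skew hJ hB
  have hinj : Function.Injective B := by
    rw [injective_iff_map_eq_zero]
    intro v hv
    by_contra h
    simpa [hv] using hpos v h
  obtain ⟨A, hA⟩ := (LinearMap.injective_iff_surjective_of_finrank_eq_finrank
      (f := B) Subspace.dual_finrank_eq.symm).1 hinj α
  subst hA
  -- With A the vector dual to α, T is an explicit sum of two rank-one maps, a multiple of the
  -- identity and a multiple of J. The rank-one maps each have trace α(y), the identity contributes
  -- -dim V · α(y), and J contributes nothing.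
  have hT' : T = (1 / 2 : ℝ) • ((B y).smulRight A - B A y • LinearMap.id +
      (B (J y)).smulRight (J A) - B A (J y) • J) := by
    ext x
    refine hinj (LinearMap.ext fun z => ?_)
    simp only [hT, leeTensor, LinearMap.smul_apply, LinearMap.sub_apply, LinearMap.add_apply,
      LinearMap.smulRight_apply, LinearMap.id_apply, map_smul, map_sub, map_add, smul_eq_mul,
      hskew A z, hskew x z, hsymm x y, hsymm x (J y)]
    ring
  rw [hT', map_smul, map_sub, map_add, map_sub, map_smul, map_smul,
    trace_eq_zero_of_skew hpos hskew, LinearMap.trace_id, LinearMap.trace_smulRight,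
    LinearMap.trace_smulRight, hB, hsymm y A]
  simp only [smul_eq_mul]
  ring

/-- Injectivity of α ↦ `leeTensor` α, from the trace formula applied to T = 0. In dimension two the
trace factor is 0, and every such tensor vanishes. -/
theorem eq_zero_of_leeTensor_eq_zero (hsymm : ∀ x y, B x y = B y x)
    (hpos : ∀ x, x ≠ 0 → 0 < B x x) (hJ : ∀ x, J (J x) = -x)
    (hB : ∀ x y, B (J x) (J y) = B x y) (hV : Module.finrank ℝ V ≠ 2) (α : V →ₗ[ℝ] ℝ)
    (hα : ∀ x y z, leeTensor (fun x y => B x y) J α x y z = 0) : α = 0 := by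
  ext y
  have h := trace_of_leeTensor hsymm hpos hJ hB α 0 y fun x z => by simp [hα]
  have hV' : (1 - (Module.finrank ℝ V : ℝ) / 2) ≠ 0 := by
    intro h0
    apply hV
    have : (Module.finrank ℝ V : ℝ) = 2 := by linarith
    exact_mod_cast this
  rw [map_zero] at h
  simpa using (mul_eq_zero.1 h.symm).resolve_left hV'

end LinearAlgebra

end LeeTensor

/-! ### The Lee form and its smoothness. -/

section LeeForm

variable {d : ℕ} {M : Type*} [TopologicalSpace M] [ChartedSpace (EuclideanSpace ℝ (Fin d)) M]
  [IsManifold (𝓡 d) ∞ M] {g : FormField d M} {J : EndField d M} {U : Set M} {p : M}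
  {W X X' Y Y' Z : VField d M} {f : M → ℝ}

theorem finrank_tangentSpace (p : M) : Module.finrank ℝ (TangentSpace (𝓡 d) p) = d :=
  finrank_euclideanSpace_fin

/-- The inner product on the tangent space at `p` as a bilinear map. -/
def bilin (g : FormField d M) (p : M) :
    TangentSpace (𝓡 d) p →ₗ[ℝ] TangentSpace (𝓡 d) p →ₗ[ℝ] ℝ :=
  LinearMap.mk₂ ℝ (fun x y => g p x y) (by simp) (by simp) (by simp) (by simp)

/-- The one-form `α` determines the tensor `h`, and vanishes in dimension two. -/
structure IsLeeForm (g : FormField d M) (J : EndField d M)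
    (α : (p : M) → TangentSpace (𝓡 d) p →L[ℝ] ℝ) : Prop where
  eq_zero : d = 2 → ∀ p, α p = 0
  secondFundamentalAt_eq : ∀ p x y z, secondFundamentalAt g J p x y z =
    1 / 2 * leeTensor (fun x y => g p x y) (fun x => J p x) (fun x => α p x) x y z

/-- The form is picked separately at each point, so nothing is known yet about its dependence on the
point. -/
theorem exists_isLeeForm {n : ℕ} {M : Type*} [TopologicalSpace M]
    [ChartedSpace (EuclideanSpace ℝ (Fin (2 * n))) M] [IsManifold (𝓡 (2 * n)) ∞ M]
    {g : FormField (2 * n) M} {J : EndField (2 * n) M} (h : IsTypeFour n g J) :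
    ∃ α, IsLeeForm g J α := by
  have h' : ∀ p : M, ∃ α : TangentSpace (𝓡 (2 * n)) p →L[ℝ] ℝ, (n = 1 → α = 0) ∧ ∀ x y z,
      secondFundamentalAt g J p x y z =
        1 / 2 * leeTensor (fun x y => g p x y) (fun x => J p x) (fun x => α x) x y z := by
    intro p
    obtain ⟨t, ht, hts⟩ := h p
    obtain ⟨α, h1, h2⟩ := exists_leeTensor_of_mem_tensorSpaceFour ht
    have : T2Space (TangentSpace (𝓡 (2 * n)) p) :=
      inferInstanceAs (T2Space (EuclideanSpace ℝ (Fin (2 * n))))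
    refine ⟨LinearMap.toContinuousLinearMap α, fun hn => by simp [h1 hn], fun x y z => ?_⟩
    rw [← hts, h2]
    rfl
  choose α h1 h2 using h'
  exact ⟨α, fun hd p => h1 p (by omega), h2⟩

namespace IsLeeForm

variable {α : (p : M) → TangentSpace (𝓡 d) p →L[ℝ] ℝ}

theorem pairing_secondFundamental (hα : IsLeeForm g J α) (h : IsAlmostHermitianOn g J univ)
    (hX : DiffAt X p) (hY : DiffAt Y p) (z : TangentSpace (𝓡 d) p) :
    g p (secondFundamental g J X Y p) z =
      1 / 2 * leeTensor (fun x y => g p x y) (fun x => J p x) (fun x => α p x) (X p) (Y p) z := by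
  rw [h.pairing_secondFundamental isOpen_univ (mem_univ p) hX hY, hα.secondFundamentalAt_eq]

/-- In a local frame `α` is, up to a factor, the trace of `X ↦ h_X Y`. -/
theorem sum_frameCoeff_secondFundamental (hα : IsLeeForm g J α)
    (h : IsAlmostHermitianOn g J univ) {q : M} (hq : q ∈ frameDomain d p) (hY : DiffAt Y q) :
    ∑ i, frameCoeff p i q (secondFundamental g J (tangentFrame p i) Y q) =
      (1 - (d : ℝ) / 2) * α q (Y q) := by
  have hT := h.secondFundamental_tensorialAt_left isOpen_univ (mem_univ q) hY
  let T := TensorialAt.mkHom _ q hT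
  have htr := trace_of_leeTensor (B := bilin g q) (J := (J q).toLinearMap)
    (fun x y => h.symm q (mem_univ q) x y) (fun x hx => h.pos q (mem_univ q) x hx)
    (fun x => h.sq q (mem_univ q) x) (fun x y => h.compatible q (mem_univ q) x y)
    (α q).toLinearMap T.toLinearMap (Y q) (fun x z => by
      have h1 : T x = secondFundamental g J
          (FiberBundle.extend (EuclideanSpace ℝ (Fin d)) x) Y q := hT.mkHom_apply_eq_extend x
      have h2 := hα.pairing_secondFundamental h (diffAt_extend x) hY z
      rw [FiberBundle.extend_apply_self] at h2
      change g q (T x) z = _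
      rw [h1, h2]
      rfl)
  rw [finrank_tangentSpace] at htr
  rw [LinearMap.trace_eq_matrix_trace ℝ ((isLocalFrameOn_tangentFrame p).toBasisAt hq),
    Matrix.trace] at htr
  refine Eq.trans (Finset.sum_congr rfl fun i _ => ?_) htr
  rw [Matrix.diag_apply, LinearMap.toMatrix_apply, IsLocalFrameOn.toBasisAt_coe]
  have h3 : T (tangentFrame p i q) = secondFundamental g J (tangentFrame p i) Y q :=
    hT.mkHom_apply ((smoothOn_tangentFrame p i).diffAt isOpen_frameDomain hq)
  change _ = ((isLocalFrameOn_tangentFrame p).toBasisAt hq).repr (T (tangentFrame p i q)) i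
  rw [h3]
  simp [frameCoeff, IsLocalFrameOn.coeff, hq]

/-- Up to the nonzero factor 1 - d/2, α(Y) is the trace of X ↦ h_X Y, whose entries in a local frame
are smooth. When d = 2 the factor vanishes, and the convention α = 0 takes over. -/
theorem contMDiffOn_apply (hα : IsLeeForm g J α) (h : IsAlmostHermitianOn g J univ)
    (hU : IsOpen U) (hY : SmoothOn Y U) :
    ContMDiffOn (𝓡 d) 𝓘(ℝ) ∞ (fun q => α q (Y q)) U := by
  by_cases hd : d = 2
  · simp only [hα.eq_zero hd, zero_apply]
    exact contMDiffOn_const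
  have hd' : (1 - (d : ℝ) / 2) ≠ 0 := by
    intro h0
    apply hd
    have : (d : ℝ) = 2 := by linarith
    exact_mod_cast this
  refine contMDiffOn_of_locally_contMDiffOn fun p hp =>
    ⟨frameDomain d p, isOpen_frameDomain, mem_frameDomain, ?_⟩
  have hU' : IsOpen (U ∩ frameDomain d p) := hU.inter isOpen_frameDomain
  have hY' := hY.mono (V := U ∩ frameDomain d p) inter_subset_left
  have hsum : ContMDiffOn (𝓡 d) 𝓘(ℝ) ∞ (fun q => (1 - (d : ℝ) / 2)⁻¹ *
      ∑ i, frameCoeff p i q (secondFundamental g J (tangentFrame p i) Y q))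
      (U ∩ frameDomain d p) := by
    refine contMDiffOn_const.mul (contMDiffOn_finsetSum fun i _ => ?_)
    have h' := h.mono (subset_univ (U ∩ frameDomain d p))
    exact contMDiffOn_frameCoeff hU' inter_subset_right (h'.smoothOn_secondFundamental hU'
      ((smoothOn_tangentFrame p i).mono inter_subset_right) hY') i
  refine hsum.congr fun q hq => ?_
  rw [hα.sum_frameCoeff_secondFundamental h hq.2 (hY'.diffAt hU' hq), inv_mul_cancel_left₀ hd']

/-- Here Y is only differentiable at p, as tensoriality arguments require; expanding Y in the frame
reduces to the smooth functions α(Eᵢ). -/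
theorem mdifferentiableAt_apply (hα : IsLeeForm g J α) (h : IsAlmostHermitianOn g J univ)
    (hY : DiffAt Y p) : MDifferentiableAt (𝓡 d) 𝓘(ℝ) (fun q => α q (Y q)) p := by
  have hsum : MDifferentiableAt (𝓡 d) 𝓘(ℝ)
      (∑ i, fun q => frameCoeff p i q (Y q) * α q (tangentFrame p i q)) p := by
    refine MDifferentiableAt.sum fun i _ => ?_
    have hi : ContMDiffOn (𝓡 d) 𝓘(ℝ) ∞ (fun q => α q (tangentFrame p i q)) (frameDomain d p) :=
      hα.contMDiffOn_apply h isOpen_frameDomain (smoothOn_tangentFrame p i)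
    exact (mdifferentiableAt_frameCoeff hY i).mul
      ((hi.contMDiffAt ((isOpen_frameDomain (d := d)).mem_nhds
        mem_frameDomain)).mdifferentiableAt (by simp))
  refine hsum.congr_of_eventuallyEq
    (Filter.eventuallyEq_of_mem ((isOpen_frameDomain (d := d)).mem_nhds mem_frameDomain) fun q hq => ?_)
  conv_lhs => rw [← sum_frameCoeff hq (Y q)]
  simp

end IsLeeForm

end LeeForm

/-! ### The Lee form is parallel and closed. -/

section Closed

variable {d : ℕ} {M : Type*} [TopologicalSpace M] [ChartedSpace (EuclideanSpace ℝ (Fin d)) M]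
  [IsManifold (𝓡 d) ∞ M] {g : FormField d M} {J : EndField d M} {U : Set M} {p : M}
  {W X X' Y Y' Z : VField d M} {f : M → ℝ}

/-- Quasi-homogeneity is tested on global fields only, so local fields are cut off by a bump
function. -/
theorem exists_smoothOn_univ [T2Space M] (hU : IsOpen U) (hp : p ∈ U) (hX : SmoothOn X U) :
    ∃ X' : VField d M, SmoothOn X' univ ∧ X' =ᶠ[𝓝 p] X := by
  obtain ⟨χ, -, hχ⟩ := (SmoothBumpFunction.nhds_basis_tsupport (I := 𝓡 d) p).mem_iff.1
    (hU.mem_nhds hp)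
  refine ⟨fun q => χ q • X q, ?_, ?_⟩
  · exact (ContMDiffOn.smul_section_of_tsupport χ.contMDiff.contMDiffOn hU hχ hX).contMDiffOn
  · filter_upwards [χ.eventuallyEq_one] with q hq
    have hq' : χ q = 1 := hq
    rw [hq', one_smul]

theorem exists_smoothOn_univ_eq [T2Space M] (x : TangentSpace (𝓡 d) p) :
    ∃ X : VField d M, SmoothOn X univ ∧ X p = x := by
  have hs : SmoothOn (fun q => ∑ i, frameCoeff p i p x • tangentFrame p i q) (frameDomain d p) :=
    ContMDiffOn.sum_section fun i _ =>
      ContMDiffOn.smul_section contMDiffOn_const (smoothOn_tangentFrame p i)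
  obtain ⟨X, hX, hXe⟩ := exists_smoothOn_univ isOpen_frameDomain mem_frameDomain hs
  exact ⟨X, hX, hXe.self_of_nhds.trans (sum_frameCoeff mem_frameDomain x)⟩

/-- Since α(JA) = ⟨A,JA⟩ = 0 and ⟨x,JA⟩ = -α(Jx), the value is ⟨x,y⟩|A|² - α(x)α(y) - α(Jx)α(Jy). -/
theorem IsAlmostHermitianOn.leeTensor_swap (h : IsAlmostHermitianOn g J U) (hp : p ∈ U)
    {α : TangentSpace (𝓡 d) p → ℝ} {A : TangentSpace (𝓡 d) p} (hA : ∀ z, g p A z = α z)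
    (x y : TangentSpace (𝓡 d) p) :
    leeTensor (fun x y => g p x y) (fun x => J p x) α x y A =
      leeTensor (fun x y => g p x y) (fun x => J p x) α y x A := by
  simp only [leeTensor, ← hA]
  have h1 := h.skew hp A A
  have h2 := h.symm p hp (J p A) A
  have h3 : g p x (J p A) = -g p A (J p x) := by rw [h.symm p hp A, h.skew hp x A, neg_neg]
  have h4 : g p y (J p A) = -g p A (J p y) := by rw [h.symm p hp A, h.skew hp y A, neg_neg]
  have h5 : g p A (J p A) = 0 := by linarith
  rw [h3, h4, h5, h.symm p hp x y, h.symm p hp x A, h.symm p hp y A]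
  ring

namespace IsLeeForm

variable {α : (p : M) → TangentSpace (𝓡 d) p →L[ℝ] ℝ}

/-- This makes (∇̄_W α)(Z) a linear form in Z(p), to which the pointwise injectivity lemma can be
applied. -/
theorem covariant_tensorialAt (hα : IsLeeForm g J α) (h : IsAlmostHermitianOn g J univ)
    (hW : DiffAt W p) :
    TensorialAt (𝓡 d) (EuclideanSpace ℝ (Fin d)) (fun Z : VField d M =>
      dirDeriv (fun q => α q (Z q)) p (W p) - α p (canonicalConnection g J W Z p)) p where
  smul {f Z} hf hZ := by
    have h1 := dirDeriv_mul (W p) hf (hα.mdifferentiableAt_apply h hZ)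
    have h2 : (fun q => α q ((f • Z) q)) = fun q => f q * α q (Z q) := by
      funext q; simp
    simp only [h2, h1, h.canonicalConnection_smul_right isOpen_univ (mem_univ p) hf hW hZ,
      map_add, map_smul, smul_eq_mul]
    ring
  add {Z Z'} hZ hZ' := by
    have h1 := dirDeriv_add (W p) (hα.mdifferentiableAt_apply h hZ)
      (hα.mdifferentiableAt_apply h hZ')
    have h2 : (fun q => α q ((Z + Z') q)) = fun q => α q (Z q) + α q (Z' q) := by
      funext q; simp
    simp only [h2, h1, h.canonicalConnection_add_right isOpen_univ (mem_univ p) hW hZ hZ', map_add]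
    ring

/-- Here γ is ∇̄_W α. Differentiating ⟨h_X Y, Z⟩ = ½ `leeTensor` α along W, every term where ∇̄_W
falls on X, Y or Z cancels, because ∇̄ preserves g and J and ∇̄h = 0. Only the terms with ∇̄_W α
remain. -/
theorem leeTensor_covariant_eq_zero (hα : IsLeeForm g J α) (h : IsAlmostHermitianOn g J univ)
    (hq : IsQuasiHomogeneous g J) (hW : SmoothOn W univ) (hX : SmoothOn X univ)
    (hY : SmoothOn Y univ) (hZ : SmoothOn Z univ)
    {γ : TangentSpace (𝓡 d) p → ℝ} (hγ : ∀ Z : VField d M, DiffAt Z p → γ (Z p) =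
      dirDeriv (fun q => α q (Z q)) p (W p) - α p (canonicalConnection g J W Z p)) :
    leeTensor (fun x y => g p x y) (fun x => J p x) γ (X p) (Y p) (Z p) = 0 := by
  have hU : IsOpen (univ : Set M) := isOpen_univ
  have hp : p ∈ (univ : Set M) := mem_univ p
  have hg := h.isMetricOn
  have dW := hW.diffAt hU hp
  have dX := hX.diffAt hU hp
  have dY := hY.diffAt hU hp
  have dZ := hZ.diffAt hU hp
  have dJY := h.diffAt_applyEnd hU hp dY
  have dJZ := h.diffAt_applyEnd hU hp dZ
  have dXY := (h.smoothOn_secondFundamental hU hX hY).diffAt hU hp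
  have dWX := (h.smoothOn_canonicalConnection hU hW hX).diffAt hU hp
  have dWY := (h.smoothOn_canonicalConnection hU hW hY).diffAt hU hp
  have mαY := hα.mdifferentiableAt_apply h dY
  have mαZ := hα.mdifferentiableAt_apply h dZ
  have mαJY := hα.mdifferentiableAt_apply h dJY
  have mαJZ := hα.mdifferentiableAt_apply h dJZ
  have mXY := hg.mdifferentiableAt_pairing hU hp dX dY
  have mXZ := hg.mdifferentiableAt_pairing hU hp dX dZ
  have mXJY := hg.mdifferentiableAt_pairing hU hp dX dJY
  have mXJZ := hg.mdifferentiableAt_pairing hU hp dX dJZ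
  have e1 := h.pairing_canonicalConnection_add hU hp dW dXY dZ
  -- ∇̄h = 0, solved for ∇̄_W(h_X Y).
  have e2 := sub_eq_zero.1 (sub_sub (canonicalConnection g J W (secondFundamental g J X Y) p) _ _ ▸
    hq W X Y hW hX hY p)
  rw [e2, map_add, add_apply, hα.pairing_secondFundamental h dWX dY,
    hα.pairing_secondFundamental h dX dWY, hα.pairing_secondFundamental h dX dY] at e1
  have e3 : (fun q => g q (secondFundamental g J X Y q) (Z q)) = fun q =>
      (1 / 2 : ℝ) * (((g q (X q) (Y q) * α q (Z q) - g q (X q) (Z q) * α q (Y q)) -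
        g q (X q) (applyEnd J Y q) * α q (applyEnd J Z q)) +
        g q (X q) (applyEnd J Z q) * α q (applyEnd J Y q)) := by
    funext q
    exact hα.pairing_secondFundamental h (hX.diffAt hU (mem_univ q)) (hY.diffAt hU (mem_univ q)) _
  have e4 : dirDeriv (fun _ : M => (1 / 2 : ℝ)) p (W p) = 0 := by
    rw [dirDeriv, mvfderiv_const]
    rfl
  have m1 : MDifferentiableAt (𝓡 d) 𝓘(ℝ) (fun q => g q (X q) (Y q) * α q (Z q)) p := mXY.mul mαZ
  have m2 : MDifferentiableAt (𝓡 d) 𝓘(ℝ) (fun q => g q (X q) (Z q) * α q (Y q)) p := mXZ.mul mαY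
  have m3 : MDifferentiableAt (𝓡 d) 𝓘(ℝ)
      (fun q => g q (X q) (applyEnd J Y q) * α q (applyEnd J Z q)) p := mXJY.mul mαJZ
  have m4 : MDifferentiableAt (𝓡 d) 𝓘(ℝ)
      (fun q => g q (X q) (applyEnd J Z q) * α q (applyEnd J Y q)) p := mXJZ.mul mαJY
  have m12 : MDifferentiableAt (𝓡 d) 𝓘(ℝ)
      (fun q => g q (X q) (Y q) * α q (Z q) - g q (X q) (Z q) * α q (Y q)) p := m1.sub m2
  have m13 : MDifferentiableAt (𝓡 d) 𝓘(ℝ)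
      (fun q => (g q (X q) (Y q) * α q (Z q) - g q (X q) (Z q) * α q (Y q)) -
        g q (X q) (applyEnd J Y q) * α q (applyEnd J Z q)) p := m12.sub m3
  have m14 : MDifferentiableAt (𝓡 d) 𝓘(ℝ)
      (fun q => ((g q (X q) (Y q) * α q (Z q) - g q (X q) (Z q) * α q (Y q)) -
        g q (X q) (applyEnd J Y q) * α q (applyEnd J Z q)) +
        g q (X q) (applyEnd J Z q) * α q (applyEnd J Y q)) p := m13.add m4
  rw [e3, dirDeriv_mul _ mdifferentiableAt_const m14, dirDeriv_add _ m13 m4,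
    dirDeriv_sub _ m12 m3, dirDeriv_sub _ m1 m2, dirDeriv_mul _ mXY mαZ, dirDeriv_mul _ mXZ mαY,
    dirDeriv_mul _ mXJY mαJZ, dirDeriv_mul _ mXJZ mαJY, e4,
    ← h.pairing_canonicalConnection_add hU hp dW dX dY,
    ← h.pairing_canonicalConnection_add hU hp dW dX dZ,
    ← h.pairing_canonicalConnection_add hU hp dW dX dJY,
    ← h.pairing_canonicalConnection_add hU hp dW dX dJZ,
    h.canonicalConnection_applyEnd hU hp dW dY, h.canonicalConnection_applyEnd hU hp dW dZ] at e1
  have g1 := hγ Y dY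
  have g2 := hγ Z dZ
  have g3 := hγ _ dJY
  have g4 := hγ _ dJZ
  rw [h.canonicalConnection_applyEnd hU hp dW dY] at g3
  rw [h.canonicalConnection_applyEnd hU hp dW dZ] at g4
  simp only [leeTensor, applyEnd] at e1 g1 g2 g3 g4 ⊢
  rw [g1, g2, g3, g4]
  linarith

/-- The Lee form is parallel for the canonical connection. -/
theorem dirDeriv_apply [T2Space M] (hα : IsLeeForm g J α) (h : IsAlmostHermitianOn g J univ)
    (hq : IsQuasiHomogeneous g J) (hW : SmoothOn W univ) (hZ : SmoothOn Z univ) :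
    dirDeriv (fun q => α q (Z q)) p (W p) = α p (canonicalConnection g J W Z p) := by
  by_cases hd : d = 2
  · simp only [hα.eq_zero hd, zero_apply]
    rw [dirDeriv, mvfderiv_const]
    rfl
  have hT := hα.covariant_tensorialAt h (hW.diffAt isOpen_univ (mem_univ p))
  let γ := TensorialAt.mkHom _ p hT
  have hγ : ∀ Z : VField d M, DiffAt Z p → γ (Z p) =
      dirDeriv (fun q => α q (Z q)) p (W p) - α p (canonicalConnection g J W Z p) :=
    fun Z hZ => hT.mkHom_apply hZ
  have h0 : γ.toLinearMap = 0 := by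
    refine eq_zero_of_leeTensor_eq_zero (B := bilin g p) (J := (J p).toLinearMap)
      (fun x y => h.symm p (mem_univ p) x y) (fun x hx => h.pos p (mem_univ p) x hx)
      (fun x => h.sq p (mem_univ p) x) (fun x y => h.compatible p (mem_univ p) x y)
      (by rwa [finrank_tangentSpace]) _ fun x y z => ?_
    obtain ⟨X, hX, rfl⟩ := exists_smoothOn_univ_eq x
    obtain ⟨Y, hY, rfl⟩ := exists_smoothOn_univ_eq y
    obtain ⟨Z, hZ, rfl⟩ := exists_smoothOn_univ_eq z
    exact hα.leeTensor_covariant_eq_zero h hq hW hX hY hZ hγ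
  have h1 := hγ Z (hZ.diffAt isOpen_univ (mem_univ p))
  have h2 : γ (Z p) = 0 := LinearMap.congr_fun h0 (Z p)
  linarith

/-- The Lee form is closed. -/
theorem dirDeriv_sub_dirDeriv [T2Space M] (hα : IsLeeForm g J α)
    (h : IsAlmostHermitianOn g J univ) (hq : IsQuasiHomogeneous g J) (hX : SmoothOn X univ)
    (hY : SmoothOn Y univ) :
    dirDeriv (fun q => α q (Y q)) p (X p) - dirDeriv (fun q => α q (X q)) p (Y p) =
      α p (VectorField.mlieBracket (𝓡 d) X Y p) := by
  have hU : IsOpen (univ : Set M) := isOpen_univ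
  have hp : p ∈ (univ : Set M) := mem_univ p
  have dX := hX.diffAt hU hp
  have dY := hY.diffAt hU hp
  obtain ⟨A, hA⟩ := h.isMetricOn.exists_riesz hp (α p).toLinearMap
  have hA' : ∀ z, g p A z = α p z := hA
  -- The torsion of ∇̄ is h_Y X - h_X Y, and α kills it: α(h_X Y) = ⟨h_X Y, A⟩ is symmetric in X and
  -- Y.
  have h1 : α p (secondFundamental g J X Y p) = α p (secondFundamental g J Y X p) := by
    rw [← hA', ← hA', h.symm p hp A, h.symm p hp A, hα.pairing_secondFundamental h dX dY,
      hα.pairing_secondFundamental h dY dX, h.leeTensor_swap hp hA']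
  rw [hα.dirDeriv_apply h hq hX hY, hα.dirDeriv_apply h hq hY hX, ← map_sub,
    h.canonicalConnection_sub_swap hU hp dX dY, map_add, map_sub, h1]
  ring

end IsLeeForm

end Closed

/-! ### The Poincaré lemma in a chart. -/

section Exact

section Poincare

variable {E : Type*} [NormedAddCommGroup E] [NormedSpace ℝ E] {M : Type*} [TopologicalSpace M]
  [ChartedSpace E M] {p q : M} {f : M → ℝ} {α : (p : M) → TangentSpace 𝓘(ℝ, E) p →L[ℝ] ℝ}

/-- The vector field with constant coordinates `w` in the chart at `p`. -/
def coordField (p : M) (w : E) : (q : M) → TangentSpace 𝓘(ℝ, E) q :=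
  VectorField.mpullback 𝓘(ℝ, E) 𝓘(ℝ, E) (extChartAt 𝓘(ℝ, E) p) fun _ => w

theorem contMDiff_constField (w : E) : ContMDiff 𝓘(ℝ, E) 𝓘(ℝ, E).tangent ∞
    (fun x => (⟨x, w⟩ : TangentBundle 𝓘(ℝ, E) E)) :=
  contMDiff_vectorSpace_iff_contDiff.2 contDiff_const

theorem mlieBracket_constField (v w x : E) :
    VectorField.mlieBracket 𝓘(ℝ, E) (fun _ : E => v) (fun _ => w) x = 0 := by
  have h : VectorField.mlieBracketWithin 𝓘(ℝ, E) (fun _ : E => v) (fun _ => w) univ x =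
      VectorField.lieBracketWithin ℝ (fun _ : E => v) (fun _ => w) univ x :=
    congrFun VectorField.mlieBracketWithin_eq_lieBracketWithin x
  rw [VectorField.lieBracketWithin_univ] at h
  have h' : VectorField.lieBracket ℝ (fun _ : E => v) (fun _ => w) x = (0 : E) := by
    simp [VectorField.lieBracket_eq]
  exact (congrFun VectorField.mlieBracketWithin_univ x).symm.trans (h.trans h')

/-- The one-form `α` written in the chart at `p`. -/
def chartForm (α : (p : M) → TangentSpace 𝓘(ℝ, E) p →L[ℝ] ℝ) (p : M) (x : E) : E →L[ℝ] ℝ :=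
  (α ((extChartAt 𝓘(ℝ, E) p).symm x)).comp
    (mfderiv 𝓘(ℝ, E) 𝓘(ℝ, E) (extChartAt 𝓘(ℝ, E) p) ((extChartAt 𝓘(ℝ, E) p).symm x)).inverse

theorem chartForm_apply (x w : E) : chartForm α p x w =
    α ((extChartAt 𝓘(ℝ, E) p).symm x) (coordField p w ((extChartAt 𝓘(ℝ, E) p).symm x)) := rfl

variable [IsManifold 𝓘(ℝ, E) ∞ M]

theorem isInvertible_mfderiv_chart (hq : q ∈ (extChartAt 𝓘(ℝ, E) p).source) :
    (mfderiv 𝓘(ℝ, E) 𝓘(ℝ, E) (extChartAt 𝓘(ℝ, E) p) q).IsInvertible := by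
  have : IsManifold 𝓘(ℝ, E) 1 M := IsManifold.of_le (n := ∞) (by simp)
  exact isInvertible_mfderiv_extChartAt hq

theorem contMDiffAt_chart (hq : q ∈ (extChartAt 𝓘(ℝ, E) p).source) :
    ContMDiffAt 𝓘(ℝ, E) 𝓘(ℝ, E) ∞ (extChartAt 𝓘(ℝ, E) p) q :=
  contMDiffAt_extChartAt' (by rwa [extChartAt_source] at hq)

theorem contMDiffOn_coordField [CompleteSpace E] (p : M) (w : E) :
    ContMDiffOn 𝓘(ℝ, E) 𝓘(ℝ, E).tangent ∞
      (fun q => (⟨q, coordField p w q⟩ : TangentBundle 𝓘(ℝ, E) M))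
      (extChartAt 𝓘(ℝ, E) p).source := by
  have : IsManifold 𝓘(ℝ, E) 1 M := IsManifold.of_le (n := ∞) (by simp)
  intro q hq
  exact (ContMDiffAt.mpullback_vectorField_preimage (contMDiff_constField w _)
    (contMDiffAt_chart hq) (isInvertible_mfderiv_chart hq) (by simp)).contMDiffWithinAt

/-- Brackets commute with pullback by the chart, and constant fields commute. Closedness on
coordinate fields thus carries no bracket term. -/
theorem mlieBracket_coordField [CompleteSpace E] (hq : q ∈ (extChartAt 𝓘(ℝ, E) p).source)
    (v w : E) : VectorField.mlieBracket 𝓘(ℝ, E) (coordField p v) (coordField p w) q = 0 := by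
  have hle : minSmoothness ℝ 2 ≤ ∞ := by
    simpa using WithTop.coe_le_coe.2 (le_top : (2 : ℕ∞) ≤ ⊤)
  have : IsManifold 𝓘(ℝ, E) (minSmoothness ℝ 2) M := IsManifold.of_le hle
  unfold coordField
  rw [← VectorField.mpullback_mlieBracket ((contMDiff_constField v).mdifferentiable (by simp) _)
      ((contMDiff_constField w).mdifferentiable (by simp) _) (contMDiffAt_chart hq) hle,
    VectorField.mpullback_apply]
  exact (congrArg _ (mlieBracket_constField v w _)).trans (map_zero _)

theorem mvfderiv_comp_chart (hq : q ∈ (extChartAt 𝓘(ℝ, E) p).source)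
    {F : E → ℝ} (hF : DifferentiableAt ℝ F (extChartAt 𝓘(ℝ, E) p q))
    (v : TangentSpace 𝓘(ℝ, E) q) :
    mvfderiv 𝓘(ℝ, E) (fun q => F (extChartAt 𝓘(ℝ, E) p q)) q v =
      fderiv ℝ F (extChartAt 𝓘(ℝ, E) p q)
        (mfderiv 𝓘(ℝ, E) 𝓘(ℝ, E) (extChartAt 𝓘(ℝ, E) p) q v) := by
  have h := mfderiv_comp q hF.mdifferentiableAt ((contMDiffAt_chart hq).mdifferentiableAt (by simp))
  rw [mfderiv_eq_fderiv] at h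
  exact congrArg (fun L => L v) h

theorem mvfderiv_coordField (hq : q ∈ (extChartAt 𝓘(ℝ, E) p).source)
    (hf : DifferentiableAt ℝ (f ∘ (extChartAt 𝓘(ℝ, E) p).symm) (extChartAt 𝓘(ℝ, E) p q)) (w : E) :
    mvfderiv 𝓘(ℝ, E) f q (coordField p w q) =
      fderiv ℝ (f ∘ (extChartAt 𝓘(ℝ, E) p).symm) (extChartAt 𝓘(ℝ, E) p q) w := by
  have h : f =ᶠ[𝓝 q] fun q => (f ∘ (extChartAt 𝓘(ℝ, E) p).symm) (extChartAt 𝓘(ℝ, E) p q) := by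
    filter_upwards [extChartAt_source_mem_nhds' (I := 𝓘(ℝ, E)) hq] with r hr
    exact congrArg f ((extChartAt 𝓘(ℝ, E) p).left_inv hr).symm
  have h1 : mvfderiv 𝓘(ℝ, E) f q (coordField p w q) =
      mvfderiv 𝓘(ℝ, E) (fun q => (f ∘ (extChartAt 𝓘(ℝ, E) p).symm) (extChartAt 𝓘(ℝ, E) p q)) q
        (coordField p w q) := by
    simp only [mvfderiv, h.mfderiv_eq]
    rfl
  rw [h1, mvfderiv_comp_chart hq hf]
  exact congrArg _ ((isInvertible_mfderiv_chart hq).self_apply_inverse w)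

theorem contDiffOn_chartForm_apply (hs : ∀ w, ContMDiffOn 𝓘(ℝ, E) 𝓘(ℝ) ∞
      (fun q => α q (coordField p w q)) (extChartAt 𝓘(ℝ, E) p).source) (w : E) :
    ContDiffOn ℝ ∞ (fun x => chartForm α p x w) (extChartAt 𝓘(ℝ, E) p).target :=
  contMDiffOn_iff_contDiffOn.1 ((hs w).comp (contMDiffOn_extChartAt_symm p)
    fun _ hx => (extChartAt 𝓘(ℝ, E) p).map_target hx)

/-- The Poincaré lemma: a smooth closed one-form is locally the differential of a smooth
function. -/
theorem exists_mvfderiv_eq [FiniteDimensional ℝ E] (hs : ∀ w, ContMDiffOn 𝓘(ℝ, E) 𝓘(ℝ) ∞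
      (fun q => α q (coordField p w q)) (extChartAt 𝓘(ℝ, E) p).source)
    (hc : ∀ q ∈ (extChartAt 𝓘(ℝ, E) p).source, ∀ v w,
      mvfderiv 𝓘(ℝ, E) (fun q => α q (coordField p w q)) q (coordField p v q) =
        mvfderiv 𝓘(ℝ, E) (fun q => α q (coordField p v q)) q (coordField p w q)) :
    ∃ U : Set M, IsOpen U ∧ p ∈ U ∧ ∃ ρ : M → ℝ, ContMDiffOn 𝓘(ℝ, E) 𝓘(ℝ) ∞ ρ U ∧
      ∀ q ∈ U, ∀ v : TangentSpace 𝓘(ℝ, E) q, mvfderiv 𝓘(ℝ, E) ρ q v = α q v := by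
  have ht : IsOpen (extChartAt 𝓘(ℝ, E) p).target := isOpen_extChartAt_target p
  obtain ⟨r, hr, hB⟩ := Metric.isOpen_iff.1 ht _ (mem_extChartAt_target p)
  set B := Metric.ball (extChartAt 𝓘(ℝ, E) p p) r
  have hω : ContDiffOn ℝ ∞ (chartForm α p) B :=
    (contDiffOn_clm_apply.2 (contDiffOn_chartForm_apply hs)).mono hB
  have hωd : DifferentiableOn ℝ (chartForm α p) B := hω.differentiableOn (by simp)
  have hsymm : ∀ a ∈ B, ∀ x y,
      fderiv ℝ (chartForm α p) a x y = fderiv ℝ (chartForm α p) a y x := by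
    intro a ha
    have hq := (extChartAt 𝓘(ℝ, E) p).map_target (hB ha)
    have hd : DifferentiableAt ℝ (chartForm α p) a :=
      hωd.differentiableAt (Metric.isOpen_ball.mem_nhds ha)
    -- The derivative of α(∂_w) along ∂_v is the derivative of the chart form, so closedness becomes
    -- symmetry of that derivative.
    have key : ∀ v w, mvfderiv 𝓘(ℝ, E) (fun q => α q (coordField p w q))
        ((extChartAt 𝓘(ℝ, E) p).symm a) (coordField p v _) = fderiv ℝ (chartForm α p) a v w := by
      intro v w
      have h1 : (fun q => α q (coordField p w q)) ∘ (extChartAt 𝓘(ℝ, E) p).symm =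
          fun x => chartForm α p x w := rfl
      have h2 : extChartAt 𝓘(ℝ, E) p ((extChartAt 𝓘(ℝ, E) p).symm a) = a :=
        (extChartAt 𝓘(ℝ, E) p).right_inv (hB ha)
      have h3 : HasFDerivAt (fun x => chartForm α p x w)
          ((ContinuousLinearMap.apply ℝ ℝ w).comp (fderiv ℝ (chartForm α p) a)) a :=
        (ContinuousLinearMap.apply ℝ ℝ w).hasFDerivAt.comp a hd.hasFDerivAt
      rw [mvfderiv_coordField hq (by rw [h1, h2]; exact h3.differentiableAt), h1, h2, h3.fderiv]
      rfl
    intro x y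
    rw [← key, ← key]
    exact hc _ hq x y
  -- On the convex ball a form with symmetric derivative has a primitive.
  obtain ⟨F, hF⟩ := (convex_ball _ r).exists_forall_hasFDerivAt_of_fderiv_symmetric
    Metric.isOpen_ball hωd hsymm
  have hFs : ContDiffOn ℝ ∞ F B := by
    rw [contDiffOn_infty_iff_fderiv_of_isOpen Metric.isOpen_ball]
    exact ⟨fun a ha => (hF a ha).differentiableAt.differentiableWithinAt,
      hω.congr fun a ha => (hF a ha).fderiv⟩
  refine ⟨(extChartAt 𝓘(ℝ, E) p).source ∩ extChartAt 𝓘(ℝ, E) p ⁻¹' B,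
    (continuousOn_extChartAt p).isOpen_inter_preimage (isOpen_extChartAt_source p)
      Metric.isOpen_ball, ⟨mem_extChartAt_source p, Metric.mem_ball_self hr⟩,
    fun q => F (extChartAt 𝓘(ℝ, E) p q), ?_, fun q hq v => ?_⟩
  · have hch : ContMDiffOn 𝓘(ℝ, E) 𝓘(ℝ, E) ∞ (extChartAt 𝓘(ℝ, E) p)
        ((extChartAt 𝓘(ℝ, E) p).source ∩ extChartAt 𝓘(ℝ, E) p ⁻¹' B) :=
      fun q hq => (contMDiffAt_chart hq.1).contMDiffWithinAt
    exact hFs.contMDiffOn.comp hch fun q hq => hq.2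
  · have hF' := hF _ hq.2
    rw [mvfderiv_comp_chart hq.1 hF'.differentiableAt, hF'.fderiv]
    refine (chartForm_apply _ _).trans ?_
    rw [(extChartAt 𝓘(ℝ, E) p).left_inv hq.1]
    exact congrArg _ ((isInvertible_mfderiv_chart hq.1).inverse_apply_self v)

end Poincare

namespace IsLeeForm

variable {d : ℕ} {M : Type*} [TopologicalSpace M] [ChartedSpace (EuclideanSpace ℝ (Fin d)) M]
  [IsManifold (𝓡 d) ∞ M] {g : FormField d M} {J : EndField d M}
  {α : (p : M) → TangentSpace (𝓡 d) p →L[ℝ] ℝ}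

/-- The Lee form is locally exact. -/
theorem exists_dirDeriv_eq [T2Space M] (hα : IsLeeForm g J α)
    (h : IsAlmostHermitianOn g J univ) (hq : IsQuasiHomogeneous g J) (p : M) :
    ∃ U : Set M, IsOpen U ∧ p ∈ U ∧ ∃ ρ : M → ℝ, ContMDiffOn (𝓡 d) 𝓘(ℝ) ∞ ρ U ∧
      ∀ q ∈ U, ∀ v : TangentSpace (𝓡 d) q, dirDeriv ρ q v = α q v := by
  have ho : IsOpen (extChartAt (𝓡 d) p).source := isOpen_extChartAt_source p
  have hs : ∀ w, SmoothOn (coordField p w) (extChartAt (𝓡 d) p).source := contMDiffOn_coordField p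
  refine exists_mvfderiv_eq (fun w => hα.contMDiffOn_apply h ho (hs w)) fun q hq' v w => ?_
  -- Closedness is known for global fields; these agree with the coordinate fields near q, which is
  -- all that derivatives and brackets see.
  obtain ⟨X, hX, hXv⟩ := exists_smoothOn_univ ho hq' (hs v)
  obtain ⟨Y, hY, hYw⟩ := exists_smoothOn_univ ho hq' (hs w)
  have h1 := hα.dirDeriv_sub_dirDeriv (p := q) h hq hX hY
  have h2 : (fun q => α q (Y q)) =ᶠ[𝓝 q] fun q => α q (coordField p w q) :=
    hYw.mono fun r hr => congrArg (α r) hr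
  have h3 : (fun q => α q (X q)) =ᶠ[𝓝 q] fun q => α q (coordField p v q) :=
    hXv.mono fun r hr => congrArg (α r) hr
  have h4 : VectorField.mlieBracket (𝓡 d) (coordField p v) (coordField p w) q = 0 :=
    mlieBracket_coordField hq' v w
  rw [dirDeriv_congr _ h2, dirDeriv_congr _ h3, hXv.mlieBracket_vectorField_eq hYw, h4,
    hXv.self_of_nhds, hYw.self_of_nhds, map_zero] at h1
  exact sub_eq_zero.1 h1

end IsLeeForm

end Exact

/-! ### Conformal change and the Kähler condition. -/

section Conformal

variable {d : ℕ} {M : Type*} [TopologicalSpace M] [ChartedSpace (EuclideanSpace ℝ (Fin d)) M]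
  [IsManifold (𝓡 d) ∞ M] {g : FormField d M} {J : EndField d M} {U : Set M} {p : M}
  {X Y Z : VField d M} {ρ : M → ℝ}

theorem conformalChange_apply (ρ : M → ℝ) (g : FormField d M) (p : M)
    (x y : TangentSpace (𝓡 d) p) :
    conformalChange ρ g p x y = Real.exp (2 * ρ p) * g p x y := rfl

theorem contMDiffOn_exp_two_mul (hρ : ContMDiffOn (𝓡 d) 𝓘(ℝ) ∞ ρ U) :
    ContMDiffOn (𝓡 d) 𝓘(ℝ) ∞ (fun q => Real.exp (2 * ρ q)) U :=
  (Real.contDiff_exp.comp (contDiff_const.mul contDiff_id)).contMDiff.comp_contMDiffOn hρ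

theorem dirDeriv_exp_two_mul (hρ : MDifferentiableAt (𝓡 d) 𝓘(ℝ) ρ p) (v : TangentSpace (𝓡 d) p) :
    dirDeriv (fun q => Real.exp (2 * ρ q)) p v = 2 * Real.exp (2 * ρ p) * dirDeriv ρ p v := by
  have h : HasDerivAt (fun t : ℝ => Real.exp (2 * t)) (Real.exp (2 * ρ p) * (2 * 1)) (ρ p) :=
    ((hasDerivAt_id _).const_mul 2).exp
  have h1 := mfderiv_comp p h.differentiableAt.mdifferentiableAt hρ
  rw [mfderiv_eq_fderiv, h.hasFDerivAt.fderiv] at h1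
  refine (congrArg (fun L => L v) h1).trans ?_
  change dirDeriv ρ p v * (Real.exp (2 * ρ p) * (2 * 1)) = _
  ring

theorem IsAlmostHermitianOn.conformalChange (h : IsAlmostHermitianOn g J U)
    (hρ : ContMDiffOn (𝓡 d) 𝓘(ℝ) ∞ ρ U) :
    IsAlmostHermitianOn (conformalChange ρ g) J U where
  contMDiffOn_metric := ContMDiffOn.smul_section (contMDiffOn_exp_two_mul hρ) h.contMDiffOn_metric
  symm p hp x y := by simp only [conformalChange_apply, h.symm p hp x y]
  pos p hp x hx := mul_pos (Real.exp_pos _) (h.pos p hp x hx)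
  contMDiffOn_complex := h.contMDiffOn_complex
  sq := h.sq
  compatible p hp x y := by simp only [conformalChange_apply, h.compatible p hp x y]

theorem koszul_conformalChange (hg : IsMetricOn g U) (hU : IsOpen U) (hp : p ∈ U)
    (hρ : MDifferentiableAt (𝓡 d) 𝓘(ℝ) ρ p) (hX : DiffAt X p) (hY : DiffAt Y p)
    (hZ : DiffAt Z p) :
    koszul (conformalChange ρ g) X Y Z p = Real.exp (2 * ρ p) * (koszul g X Y Z p +
      dirDeriv ρ p (X p) * g p (Y p) (Z p) + dirDeriv ρ p (Y p) * g p (Z p) (X p) -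
      dirDeriv ρ p (Z p) * g p (X p) (Y p)) := by
  have he : MDifferentiableAt (𝓡 d) 𝓘(ℝ) (fun q => Real.exp (2 * ρ q)) p :=
    MDifferentiableAt.comp p (g := fun t : ℝ => Real.exp (2 * t)) (I' := 𝓘(ℝ))
      (by fun_prop : DifferentiableAt ℝ (fun t : ℝ => Real.exp (2 * t)) (ρ p)).mdifferentiableAt hρ
  simp only [koszul, conformalChange_apply,
    dirDeriv_mul _ he (hg.mdifferentiableAt_pairing hU hp hY hZ),
    dirDeriv_mul _ he (hg.mdifferentiableAt_pairing hU hp hZ hX),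
    dirDeriv_mul _ he (hg.mdifferentiableAt_pairing hU hp hX hY), dirDeriv_exp_two_mul hρ]
  ring

/-- `A` is the g-gradient of ρ at p. The common factor e^{2ρ} drops out because the new connection
is paired with the new metric. -/
theorem leviCivita_conformalChange (hg : IsMetricOn g U)
    (hg' : IsMetricOn (conformalChange ρ g) U) (hU : IsOpen U) (hp : p ∈ U)
    (hρ : MDifferentiableAt (𝓡 d) 𝓘(ℝ) ρ p) {A : TangentSpace (𝓡 d) p}
    (hA : ∀ z, g p A z = dirDeriv ρ p z) (hX : DiffAt X p) (hY : DiffAt Y p) :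
    leviCivita (conformalChange ρ g) X Y p = leviCivita g X Y p + dirDeriv ρ p (X p) • Y p +
      dirDeriv ρ p (Y p) • X p - g p (X p) (Y p) • A := by
  refine leviCivita_eq hg' hU hp hX hY fun Z hZ => ?_
  rw [koszul_conformalChange hg hU hp hρ hX hY hZ, conformalChange_apply,
    ← pairing_leviCivita hg hU hp hX hY hZ, hg.symm p hp (Z p) (X p), ← hA (Z p)]
  simp only [map_sub, map_add, map_smul, sub_apply, add_apply, smul_apply, smul_eq_mul]
  ring

theorem IsLeeForm.isKahlerOn_conformalChange {α : (p : M) → TangentSpace (𝓡 d) p →L[ℝ] ℝ}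
    (hα : IsLeeForm g J α) (h : IsAlmostHermitianOn g J univ) (hU : IsOpen U)
    (hρ : ContMDiffOn (𝓡 d) 𝓘(ℝ) ∞ ρ U)
    (hρα : ∀ q ∈ U, ∀ v : TangentSpace (𝓡 d) q, dirDeriv ρ q v = α q v) :
    IsKahlerOn (conformalChange ρ g) J U := by
  have h₁ := h.mono (subset_univ U)
  have h₂ := h₁.conformalChange hρ
  refine ⟨h₂, fun X Y hX hY p hp => ?_⟩
  have dX := hX.diffAt hU hp
  have dY := hY.diffAt hU hp
  have dJY := h₁.diffAt_applyEnd hU hp dY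
  have mρ := (hρ.contMDiffAt (hU.mem_nhds hp)).mdifferentiableAt (by simp)
  obtain ⟨A, hA⟩ := h₁.isMetricOn.exists_riesz hp (α p).toLinearMap
  have hA' : ∀ z, g p A z = α p z := hA
  have hA'' : ∀ z, g p A z = dirDeriv ρ p z := fun z => (hA' z).trans (hρα p hp z).symm
  rw [leviCivita_conformalChange h₁.isMetricOn h₂.isMetricOn hU hp mρ hA'' dX dY,
    leviCivita_conformalChange h₁.isMetricOn h₂.isMetricOn hU hp mρ hA'' dX dJY]
  refine h₁.isMetricOn.eq_of_pairing_eq hp fun z => ?_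
  -- Pairing with Jz is the right form: ⟨∇_X(JY) - J∇_X Y, z⟩ = 2⟨h_X Y, Jz⟩, which the gradient
  -- terms of the new connection cancel.
  have e := hα.pairing_secondFundamental h dX dY (J p z)
  rw [IsAlmostHermitianOn.secondFundamental_eq] at e
  have s1 := h₁.skew hp (X p) z
  have s2 := h₁.skew hp A z
  have s3 := h₁.skew hp (leviCivita g X Y p) z
  have s4 := h₁.compatible p hp (leviCivita g X (applyEnd J Y) p) z
  simp only [leeTensor, applyEnd, h₁.sq p hp, map_sub, map_add, map_neg, map_smul, sub_apply,
    add_apply, smul_apply, smul_eq_mul, hρα p hp, s1, s2, s3, s4, hA'] at e ⊢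
  linarith

end Conformal

end AlmostHermitian


end

theorem theorem5p27 (n : ℕ) (M : Type*) [TopologicalSpace M] [T2Space M]
    [ChartedSpace (EuclideanSpace ℝ (Fin (2 * n))) M] [IsManifold (𝓡 (2 * n)) ∞ M]
    (g : ContMDiffRiemannianMetric (𝓡 (2 * n)) ∞ (EuclideanSpace ℝ (Fin (2 * n)))
      (fun p : M => TangentSpace (𝓡 (2 * n)) p))
    (J : (p : M) → TangentSpace (𝓡 (2 * n)) p →L[ℝ] TangentSpace (𝓡 (2 * n)) p)
    (hJ : AlmostHermitian.IsAlmostHermitianOn g.inner J univ)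
    (hquasi : AlmostHermitian.IsQuasiHomogeneous g.inner J)
    (htype : AlmostHermitian.IsTypeFour n g.inner J) :
    ∀ p : M, ∃ U : Set M, IsOpen U ∧ p ∈ U ∧ ∃ ρ : M → ℝ,
      ContMDiffOn (𝓡 (2 * n)) 𝓘(ℝ, ℝ) ∞ ρ U ∧
      AlmostHermitian.IsKahlerOn (AlmostHermitian.conformalChange ρ g.inner) J U := by
  intro p
  obtain ⟨α, hα⟩ := AlmostHermitian.exists_isLeeForm htype
  obtain ⟨U, hU, hp, ρ, hρ, hρα⟩ := hα.exists_dirDeriv_eq hJ hquasi p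
  exact ⟨U, hU, hp, ρ, hρ, hα.isKahlerOn_conformalChange hJ hU hρ hρα⟩
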